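/- **Guided random walk.** Let $(x_t)_{t\ge 0}$ be a nearest-neighbour walk in $\mathbb Z^2$ with $x_0=0$ (the instructions) and let $p\in[0,1]$. The guided random walk is $X_0=0$ and, independently in each step, $X_{t+1}-X_t=x_{t+1}-x_t$ with probability $1-p$, while with probability $p$ it is uniform on $\{(\pm1,0),(0,\pm1)\}$. For $x_{\mathrm{home}}\in\mathbb Z^2$ let $T=\inf\{t\ge 0: X_t=x_{\mathrm{home}}\}\in\mathbb N\cup\{\infty\}$. **Sweeping strategy with parameters $p_0\in(0,1)$ and $A,B>0$.** The first $t_0\geq 2$ instructions form an arbitrary fixed closed walk from the origin to itself. From time $t_0$ on, the instructions consist of consecutive phases, each of which starts and ends with $x_t=0$. For a phase that starts at time $t$ put $$W=\Big\lceil \tfrac{A\sqrt t}{1-p_0}\Big\rceil,\quad H=\Big\lceil \tfrac{B\sqrt t}{1-p_0}\Big\rceil,\quad G=\Big\lceil \tfrac{1}{1-p_0}\tfrac{\sqrt t}{\ln t}\Big\rceil,\quad N=\Big\lceil \tfrac{2H}{G}\Big\rceil,\quad M=G+\lceil t^{1/3}\rceil,$$ and let $Z$ be uniform on $\{1,\dots,M\}$,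 independently for each phase and independently of the mistakes of the agent. The instructions of the phase are: 1. $W$ steps west, then $H$ steps south; 2. $Z$ steps north; 3. $N$ horizontal lines of $2W$ steps each, alternatingly to the east and to the west (the first to the east), with $G$ steps north between consecutive lines; 4. $M-Z$ steps north, and then a shortest return to $(0,0)$, first horizontally and then vertically. (The duration of a phase does not depend on $Z$.) **Proposition.** Let $0<p_0<1$, $\alpha>0$, and suppose that $a>0$ satisfies $$\left(1-4e^{-\frac{a^2}{4}+2\alpha}\right)\frac{(1-p_0)^2}{2a^2p_0\sqrt{3-2p_0}}>\alpha .$$ Then, for every $0\le p\le p_0$ and every $x_{\mathrm{home}}\in\mathbb Z^2$, the guided random walk with mistake probability $p$ that follows the sweeping strategy with parameters $A=a\sqrt{\frac{p_0}{2}(3-2p_0)}$ and $B=a\sqrt{\frac{p_0}{2}}$ satisfies $\mathbb P(T>t)=O(t^{-\alpha})$ as $t\to\infty$. In particular, if $\alpha>1$, then $\mathbb E[T]<\infty$. -/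

import Mathlib

open MeasureTheory ProbabilityTheory Filter

namespace GuidedWalk

/-- The four cardinal directions. -/
inductive Dir
  | east | west | north | south
  deriving DecidableEq

/-- The unit vector of a cardinal direction. -/
def Dir.vec : Dir → ℤ × ℤ
  | .east => (1, 0)
  | .west => (-1, 0)
  | .north => (0, 1)
  | .south => (0, -1)

/-- The displacement produced by a finite list of moves. -/
def displacement (l : List Dir) : ℤ × ℤ := (l.map Dir.vec).sum

/-- What the agent does in one time step: it follows the current instruction, or it makes a mistake
and moves in the given direction. -/
inductive Outcome
  | follow
  | mistake (d : Dir)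
  deriving DecidableEq

instance : MeasurableSpace Outcome := ⊤

/-- The position at time `t` of the agent started at the origin, when the instructions are
the walk `x` and the outcomes of the successive time steps are `ξ 0, ξ 1, …`. -/
def guidedWalk (x : ℕ → ℤ × ℤ) (ξ : ℕ → Outcome) : ℕ → ℤ × ℤ
  | 0 => 0
  | t + 1 => guidedWalk x ξ t +
      match ξ t with
      | .follow => x (t + 1) - x t
      | .mistake d => d.vec

/-- The first time at which the trajectory `X` is at `home` (`⊤` if there is none). -/
noncomputable def hittingTime (X : ℕ → ℤ × ℤ) (home : ℤ × ℤ) : ℕ∞ :=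
  ⨅ (t : ℕ) (_ : X t = home), (t : ℕ∞)

/-! ### The sweeping strategy -/

section Strategy

variable (p₀ A B : ℝ)

/-- Half of the width of the swept box, for a phase starting at time `t`. -/
noncomputable def boxW (t : ℕ) : ℕ := ⌈1 / (1 - p₀) * A * √(t : ℝ)⌉₊

/-- Half of the height of the swept box, for a phase starting at time `t`. -/
noncomputable def boxH (t : ℕ) : ℕ := ⌈1 / (1 - p₀) * B * √(t : ℝ)⌉₊

/-- The gap between consecutive horizontal lines. -/
noncomputable def gap (t : ℕ) : ℕ := ⌈1 / (1 - p₀) * (√(t : ℝ) / Real.log t)⌉₊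

/-- The number of horizontal lines. -/
noncomputable def numLines (t : ℕ) : ℕ := ⌈2 * (boxH p₀ B t : ℝ) / (gap p₀ t : ℝ)⌉₊

/-- The random shift of a phase starting at time `t` is uniform on `{1, …, maxShift t}`. -/
noncomputable def maxShift (t : ℕ) : ℕ := gap p₀ t + ⌈(t : ℝ) ^ ((1 : ℝ) / 3)⌉₊

/-- `n` horizontal lines of length `2 * w`, traversed alternatingly to the east and to the west
(the first one to the east), with `g` steps north between consecutive lines. -/
def zigzag (w g : ℕ) : ℕ → List Dir
  | 0 => []
  | n + 1 => zigzag w g n ++ (if n = 0 then [] else List.replicate g Dir.north) ++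
      List.replicate (2 * w) (if Even n then Dir.east else Dir.west)

/-- A shortest walk with displacement `v`: first horizontally, then vertically. -/
def straight (v : ℤ × ℤ) : List Dir :=
  List.replicate v.1.natAbs (if 0 ≤ v.1 then Dir.east else Dir.west) ++
    List.replicate v.2.natAbs (if 0 ≤ v.2 then Dir.north else Dir.south)

/-- The moves of a phase that starts at time `t` with shift `z`, up to the return to the origin. -/
noncomputable def sweep (t z : ℕ) : List Dir :=
  List.replicate (boxW p₀ A t) Dir.west ++ List.replicate (boxH p₀ B t) Dir.south ++
    List.replicate z Dir.north ++
    zigzag (boxW p₀ A t) (gap p₀ t) (numLines p₀ B t) ++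
    List.replicate (maxShift p₀ t - z) Dir.north

/-- The instructions of a phase that starts at time `t` with shift `z`. -/
noncomputable def phase (t z : ℕ) : List Dir :=
  sweep p₀ A B t z ++ straight (-displacement (sweep p₀ A B t z))

/-- The duration of a phase that starts at time `t`; see `length_phase`: it does not depend on
the shift. -/
noncomputable def phaseLength (t : ℕ) : ℕ := (phase p₀ A B t 0).length

theorem length_phase (t z : ℕ) (hz : z ≤ maxShift p₀ t) :
    (phase p₀ A B t z).length = phaseLength p₀ A B t := by
  have hd : displacement (sweep p₀ A B t z) = displacement (sweep p₀ A B t 0) := by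
    obtain ⟨k, hk⟩ := Nat.exists_eq_add_of_le hz
    have hv : (maxShift p₀ t - z) • Dir.north.vec + z • Dir.north.vec
        = maxShift p₀ t • Dir.north.vec := by
      rw [← add_smul, Nat.sub_add_cancel hz]
    simp only [displacement, sweep, List.map_append, List.sum_append, List.map_replicate,
      List.sum_replicate, Nat.sub_zero, zero_smul, add_zero]
    rw [← hv]
    abel
  have hl : (sweep p₀ A B t z).length = (sweep p₀ A B t 0).length := by
    simp only [sweep, List.length_append, List.length_replicate]
    omega
  simp only [phaseLength, phase, List.length_append, hd, hl]

/-- The starting time of phase `i`, when the first phase starts at time `t₀`. -/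
noncomputable def startTime (t₀ : ℕ) : ℕ → ℕ
  | 0 => t₀
  | i + 1 => startTime t₀ i + phaseLength p₀ A B (startTime t₀ i)

/-- The moves `l₀` made before the first phase, followed by phases `0, …, n - 1`, where phase `i`
has shift `z i`. -/
noncomputable def moves (l₀ : List Dir) (z : ℕ → ℕ) : ℕ → List Dir
  | 0 => l₀
  | n + 1 => moves l₀ z n ++ phase p₀ A B (startTime p₀ A B l₀.length n) (z n)

/-- The instructions `x_t` of the sweeping strategy with initial moves `l₀` and shifts `z`.
Every phase lasts at least one step, so the first `t` phases determine `x_t`. -/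
noncomputable def sweepingInstructions (l₀ : List Dir) (z : ℕ → ℕ) (t : ℕ) : ℤ × ℤ :=
  displacement ((moves p₀ A B l₀ z t).take t)

end Strategy

/-- The randomness of the guided random walk with mistake probability `p` that follows the sweeping
strategy: `ξ t` is the outcome of time step `t` (a mistake has probability `p`, and its direction is
then uniform), `Z i` is the shift of phase `i`, and all these random variables are independent. -/
structure IsSweepingRandomness {Ω : Type*} [MeasurableSpace Ω] (μ : Measure Ω)
    (p p₀ A B : ℝ) (t₀ : ℕ) (ξ : ℕ → Ω → Outcome) (Z : ℕ → Ω → ℕ) : Prop where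
  measurable_outcome : ∀ t, Measurable (ξ t)
  measurable_shift : ∀ i, Measurable (Z i)
  prob_follow : ∀ t, μ {ω | ξ t ω = .follow} = ENNReal.ofReal (1 - p)
  prob_mistake : ∀ t d, μ {ω | ξ t ω = .mistake d} = ENNReal.ofReal (p / 4)
  prob_shift : ∀ i, ∀ z ∈ Finset.Icc 1 (maxShift p₀ (startTime p₀ A B t₀ i)),
    μ {ω | Z i ω = z} = (maxShift p₀ (startTime p₀ A B t₀ i) : ENNReal)⁻¹
  indep_outcome : iIndepFun ξ μ
  indep_shift : iIndepFun Z μ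
  indep_outcome_shift : IndepFun (fun ω t => ξ t ω) (fun ω i => Z i ω) μ

/-- The time at which the agent that follows the sweeping strategy finds `home`. -/
noncomputable def sweepingTime {Ω : Type*} (p₀ A B : ℝ) (l₀ : List Dir)
    (ξ : ℕ → Ω → Outcome) (Z : ℕ → Ω → ℕ) (home : ℤ × ℤ) (ω : Ω) : ℕ∞ :=
  hittingTime
    (guidedWalk (sweepingInstructions p₀ A B l₀ (fun i => Z i ω)) (fun t => ξ t ω)) home

end GuidedWalk

/-!
Let `f t` be the probability that the agent has not been at home by the starting time `t` of a
phase. If the agent is then inside the box that it sweeps on average in the phase, it moves, up to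
fluctuations smaller than `t ^ (1/3)`, with speed `1 - p` along the instructions. As the shift `Z`
runs through `1, …, M`, the point where the lines start moves north along a lattice path, and a
discrete crossing argument shows that, with probability close to one, at least one of these shifts
leads the agent to home. Hence the phase finds home with probability about `1 / M`, while its length
relative to `t` is about `4AB / ((1 - p₀) ^ 2 * M)`: if the agent were always inside the box, `f t`
would decay like `t ^ (-(1 - p₀) ^ 2 / (4AB))`.

To show that the agent is rarely outside the box, compare its displacement with a sum of independent
deviations. Most instructions are horizontal, so a time step adds a variance of at most
`p / 2 * (3 - 2 * p)` to the horizontal and, on average, about `p / 2` to the vertical component.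
With exponents of order `1 / √t`, the exponential moments of the position in the four directions, on
the event that home has not been found, therefore stay below about `exp (a ^ 2 / 4 + 2 * α)` times
the bound `C * t ^ (-α)` for `f t`, whereas leaving the box makes one of the exponentials at least
about `exp (a ^ 2 / 2)`. So the four ways to leave the box cost a factor
`1 - 4 * exp (-a ^ 2 / 4 + 2 * α)` in the rate of decay, and both bounds propagate from phase to
phase by induction.
-/

namespace GuidedWalk

/-! ### Means over independent outcomes -/

instance : Fintype Dir := ⟨{.east, .west, .north, .south}, fun d => by cases d <;> simp⟩

instance : Fintype Outcome :=
  ⟨{.follow, .mistake .east, .mistake .west, .mistake .north, .mistake .south}, fun o => by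
    rcases o with _ | d
    · simp
    · cases d <;> simp⟩

/-- The probability of an outcome when mistakes have probability `p`. -/
noncomputable def outcomeProb (p : ℝ) : Outcome → ℝ
  | .follow => 1 - p
  | .mistake _ => p / 4

/-- The mean of a function of one outcome. -/
noncomputable def outcomeMean (p : ℝ) (φ : Outcome → ℝ) : ℝ := ∑ o, outcomeProb p o * φ o

/-- The mean of a function of a word of `n` independent outcomes. -/
noncomputable def wordMean (p : ℝ) : ℕ → (List Outcome → ℝ) → ℝ
  | 0, φ => φ []
  | n + 1, φ => outcomeMean p fun o => wordMean p n fun w => φ (o :: w)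

/-- The probability that a word of `n` independent outcomes belongs to `S`. -/
noncomputable def wordProb (p : ℝ) (n : ℕ) (S : Set (List Outcome)) : ℝ :=
  wordMean p n (S.indicator 1)

section Mean

variable {p : ℝ}

lemma outcomeProb_nonneg (hp : 0 ≤ p) (hp1 : p ≤ 1) (o : Outcome) : 0 ≤ outcomeProb p o := by
  cases o <;> simp only [outcomeProb] <;> linarith

lemma outcomeMean_eq (p : ℝ) (φ : Outcome → ℝ) :
    outcomeMean p φ = (1 - p) * φ .follow + p / 4 * φ (.mistake .east) +
      p / 4 * φ (.mistake .west) + p / 4 * φ (.mistake .north) + p / 4 * φ (.mistake .south) := by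
  change ∑ o ∈ ({.follow, .mistake .east, .mistake .west, .mistake .north, .mistake .south} :
    Finset Outcome), outcomeProb p o * φ o = _
  repeat rw [Finset.sum_insert (by simp)]
  rw [Finset.sum_singleton]
  simp only [outcomeProb]
  ring

lemma outcomeMean_mono (hp : 0 ≤ p) (hp1 : p ≤ 1) {φ ψ : Outcome → ℝ} (h : ∀ o, φ o ≤ ψ o) :
    outcomeMean p φ ≤ outcomeMean p ψ :=
  Finset.sum_le_sum fun o _ => mul_le_mul_of_nonneg_left (h o) (outcomeProb_nonneg hp hp1 o)

lemma outcomeMean_const (p c : ℝ) : outcomeMean p (fun _ => c) = c := by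
  rw [outcomeMean_eq]; ring

lemma outcomeMean_mul_left (p c : ℝ) (φ : Outcome → ℝ) :
    outcomeMean p (fun o => c * φ o) = c * outcomeMean p φ := by
  simp only [outcomeMean_eq]; ring

lemma wordMean_mono (hp : 0 ≤ p) (hp1 : p ≤ 1) {n : ℕ} {φ ψ : List Outcome → ℝ}
    (h : ∀ w, w.length = n → φ w ≤ ψ w) : wordMean p n φ ≤ wordMean p n ψ := by
  induction n generalizing φ ψ with
  | zero => exact h [] rfl
  | succ n ih =>
    exact outcomeMean_mono hp hp1 fun o => ih fun w hw => h _ (by rw [List.length_cons, hw])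

lemma wordMean_congr {n : ℕ} {φ ψ : List Outcome → ℝ} (h : ∀ w, w.length = n → φ w = ψ w) :
    wordMean p n φ = wordMean p n ψ := by
  induction n generalizing φ ψ with
  | zero => exact h [] rfl
  | succ n ih =>
    exact congrArg (outcomeMean p) <| funext fun o =>
      ih fun w hw => h _ (by rw [List.length_cons, hw])

lemma wordMean_const (n : ℕ) (c : ℝ) : wordMean p n (fun _ => c) = c := by
  induction n with
  | zero => rfl
  | succ n ih => simp only [wordMean, ih, outcomeMean_const]

lemma wordMean_nonneg (hp : 0 ≤ p) (hp1 : p ≤ 1) {n : ℕ} {φ : List Outcome → ℝ}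
    (h : ∀ w, w.length = n → 0 ≤ φ w) : 0 ≤ wordMean p n φ :=
  (wordMean_const n 0).ge.trans (wordMean_mono hp hp1 h)

lemma wordMean_mul_left (n : ℕ) (c : ℝ) (φ : List Outcome → ℝ) :
    wordMean p n (fun w => c * φ w) = c * wordMean p n φ := by
  induction n generalizing φ with
  | zero => rfl
  | succ n ih => simp only [wordMean, ih, outcomeMean_mul_left]

lemma wordMean_sum {ι : Type*} (s : Finset ι) (n : ℕ) (φ : ι → List Outcome → ℝ) :
    wordMean p n (fun w => ∑ i ∈ s, φ i w) = ∑ i ∈ s, wordMean p n (φ i) := by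
  induction n generalizing φ with
  | zero => rfl
  | succ n ih =>
    simp only [wordMean, ih, outcomeMean, Finset.mul_sum]
    rw [Finset.sum_comm]

lemma wordMean_sub (n : ℕ) (φ ψ : List Outcome → ℝ) :
    wordMean p n (fun w => φ w - ψ w) = wordMean p n φ - wordMean p n ψ := by
  induction n generalizing φ ψ with
  | zero => rfl
  | succ n ih =>
    simp only [wordMean, ih, outcomeMean_eq]
    ring

lemma wordMean_append (m n : ℕ) (φ : List Outcome → ℝ) :
    wordMean p (m + n) φ = wordMean p m fun u => wordMean p n fun v => φ (u ++ v) := by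
  induction m generalizing φ with
  | zero => simp only [wordMean, Nat.zero_add, List.nil_append]
  | succ m ih =>
    rw [Nat.add_right_comm]
    simp only [wordMean, ih, List.cons_append]

lemma wordMean_take {k n : ℕ} (hk : k ≤ n) (φ : List Outcome → ℝ) :
    wordMean p n (fun w => φ (w.take k)) = wordMean p k φ := by
  obtain ⟨m, rfl⟩ := Nat.exists_eq_add_of_le hk
  rw [wordMean_append]
  refine wordMean_congr fun u hu => ?_
  rw [← wordMean_const (p := p) m (φ u)]
  refine wordMean_congr fun v _ => ?_
  rw [List.take_append_of_le_length hu.ge, List.take_of_length_le hu.le]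

lemma one_sub_sum_le_wordProb (hp : 0 ≤ p) (hp1 : p ≤ 1) {ι : Type*} (T : Finset ι) {n : ℕ}
    {φ : ι → List Outcome → ℝ} {S : Set (List Outcome)} (hφ : ∀ i ∈ T, ∀ w, 0 ≤ φ i w)
    (hS : ∀ w, w.length = n → w ∉ S → ∃ i ∈ T, 1 ≤ φ i w) :
    1 - ∑ i ∈ T, wordMean p n (φ i) ≤ wordProb p n S := by
  rw [← wordMean_sum, ← wordMean_const (p := p) n 1, ← wordMean_sub]
  refine wordMean_mono hp hp1 fun w hw => ?_
  by_cases hwS : w ∈ S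
  · rw [Set.indicator_of_mem hwS]
    exact sub_le_self _ (Finset.sum_nonneg fun i hi => hφ i hi w)
  · obtain ⟨i, hi, h1⟩ := hS w hw hwS
    rw [Set.indicator_of_notMem hwS, sub_nonpos]
    exact h1.trans (Finset.single_le_sum (f := fun i => φ i w) (fun j hj => hφ j hj w) hi)

end Mean

/-! ### Exponential moments of the agent's displacement -/

/-- The move of the agent for a given instruction and a given outcome. -/
def step (d : Dir) : Outcome → ℤ × ℤ
  | .follow => d.vec
  | .mistake d' => d'.vec

/-- The displacement of an agent that is given the instructions `l` when the outcomes are `w`;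
if the lengths differ, the longer list is truncated. -/
def agentDisp (l : List Dir) (w : List Outcome) : ℤ × ℤ := (List.zipWith step l w).sum

/-- The component of a vector in a cardinal direction. -/
def Dir.comp (e : Dir) (v : ℤ × ℤ) : ℤ := e.vec.1 * v.1 + e.vec.2 * v.2

/-- The vertical directions. -/
def Dir.Vertical (d : Dir) : Prop := d = .north ∨ d = .south

instance : DecidablePred Dir.Vertical := fun _ => inferInstanceAs (Decidable (_ ∨ _))

/-- The deviation of the `e`-component of a move from its mean, given the instruction `d`. -/
noncomputable def stepDev (p : ℝ) (e d : Dir) (o : Outcome) : ℝ :=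
  e.comp (step d o) - (1 - p) * e.comp d.vec

/-- The variance of the `e`-component of a move, given the instruction `d`. -/
noncomputable def stepVar (p : ℝ) (e d : Dir) : ℝ := outcomeMean p fun o => stepDev p e d o ^ 2

lemma displacement_cons (d : Dir) (l : List Dir) :
    displacement (d :: l) = d.vec + displacement l := by
  rw [displacement, List.map_cons, List.sum_cons, displacement]

lemma displacement_append (l₁ l₂ : List Dir) :
    displacement (l₁ ++ l₂) = displacement l₁ + displacement l₂ := by
  simp only [displacement, List.map_append, List.sum_append]

lemma displacement_replicate (k : ℕ) (d : Dir) :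
    displacement (List.replicate k d) = k • d.vec := by
  simp only [displacement, List.map_replicate, List.sum_replicate]

lemma agentDisp_cons (d : Dir) (l : List Dir) (o : Outcome) (w : List Outcome) :
    agentDisp (d :: l) (o :: w) = step d o + agentDisp l w := by
  rw [agentDisp, List.zipWith_cons_cons, List.sum_cons, agentDisp]

lemma agentDisp_append {l₁ l₂ : List Dir} {w₁ w₂ : List Outcome} (h : l₁.length = w₁.length) :
    agentDisp (l₁ ++ l₂) (w₁ ++ w₂) = agentDisp l₁ w₁ + agentDisp l₂ w₂ := by
  rw [agentDisp, List.zipWith_append h, List.sum_append, agentDisp, agentDisp]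

lemma agentDisp_append_right {l : List Dir} {w₁ : List Outcome} (w₂ : List Outcome)
    (h : l.length ≤ w₁.length) : agentDisp l (w₁ ++ w₂) = agentDisp l w₁ := by
  induction l generalizing w₁ with
  | nil => rfl
  | cons d l ih =>
    obtain ⟨o, w₁, rfl⟩ := List.exists_cons_of_length_pos (by grind : 0 < w₁.length)
    rw [List.cons_append, agentDisp_cons, agentDisp_cons, ih (by simpa using h)]

lemma agentDisp_take_right {l : List Dir} {k : ℕ} (w : List Outcome) (h : l.length ≤ k) :
    agentDisp l (w.take k) = agentDisp l w := by
  rcases le_total w.length k with hw | hw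
  · rw [List.take_of_length_le hw]
  · conv_rhs => rw [← List.take_append_drop k w]
    rw [agentDisp_append_right _ (by rw [List.length_take]; omega)]

lemma exists_agentDisp_take_succ {l : List Dir} {w : List Outcome} {k : ℕ} (hl : k < l.length)
    (hw : k < w.length) :
    ∃ d : Dir, agentDisp (l.take (k + 1)) w = agentDisp (l.take k) w + d.vec := by
  have hadd : agentDisp (l.take (k + 1)) w = agentDisp (l.take k) w + step l[k] w[k] := by
    rw [← agentDisp_take_right (k := k + 1) w (by simp),
      ← agentDisp_take_right (k := k) w (by simp), ← List.take_append_getElem hl,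
      ← List.take_append_getElem hw,
      agentDisp_append (by simp; omega)]
    simp [agentDisp]
  rw [hadd]
  rcases w[k] with _ | d
  exacts [⟨l[k], rfl⟩, ⟨d, rfl⟩]

lemma Dir.comp_add (e : Dir) (v w : ℤ × ℤ) : e.comp (v + w) = e.comp v + e.comp w := by
  simp only [Dir.comp, Prod.fst_add, Prod.snd_add]; ring

section Moment

variable {p s : ℝ}

lemma outcomeMean_stepDev (p : ℝ) (e d : Dir) : outcomeMean p (stepDev p e d) = 0 := by
  rw [outcomeMean_eq]
  cases e <;> cases d <;> simp [stepDev, Dir.comp, step, Dir.vec] <;> ring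

lemma abs_stepDev_le (hp : 0 ≤ p) (hp1 : p ≤ 1) (e d : Dir) (o : Outcome) :
    |stepDev p e d o| ≤ 2 := by
  have abs_comp_le (e d : Dir) : |(e.comp d.vec : ℝ)| ≤ 1 := by
    cases e <;> cases d <;> simp [Dir.comp, Dir.vec]
  have hstep : |(e.comp (step d o) : ℝ)| ≤ 1 := by
    cases o <;> exact abs_comp_le e _
  calc |stepDev p e d o| ≤ |(e.comp (step d o) : ℝ)| + |(1 - p) * e.comp d.vec| := abs_sub _ _
    _ ≤ 1 + (1 - p) * 1 := by
      rw [abs_mul, abs_of_nonneg (sub_nonneg.mpr hp1)]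
      gcongr
      exact abs_comp_le e d
    _ ≤ 2 := by linarith

lemma stepVar_eq (p : ℝ) (e d : Dir) :
    stepVar p e d = if e.Vertical ↔ d.Vertical then p / 2 * (3 - 2 * p) else p / 2 := by
  rw [stepVar, outcomeMean_eq]
  cases e <;> cases d <;> simp [stepDev, Dir.comp, step, Dir.vec, Dir.Vertical] <;> ring

lemma stepVar_le_one (hp : 0 ≤ p) (hp1 : p ≤ 1) (e d : Dir) : stepVar p e d ≤ 1 := by
  rw [stepVar_eq]
  split_ifs
  · nlinarith [sq_nonneg (p - 1)]
  · linarith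

lemma exp_le_one_add_sq_add_cube {y : ℝ} (hy : |y| ≤ 1) :
    Real.exp y ≤ 1 + y + y ^ 2 / 2 + |y| ^ 3 := by
  have htaylor := (abs_le.mp (Real.exp_bound hy (n := 3) (by norm_num))).2
  norm_num [Finset.sum_range_succ, Nat.factorial] at htaylor
  have hcube : 0 ≤ |y| ^ 3 := by positivity
  linarith

lemma outcomeMean_exp_le (hp : 0 ≤ p) (hp1 : p ≤ 1) (hs : 0 ≤ s) (hs1 : s ≤ 1 / 2) (e d : Dir) :
    outcomeMean p (fun o => Real.exp (s * stepDev p e d o)) ≤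
      Real.exp (s ^ 2 * (stepVar p e d / 2 + 8 * s)) := by
  calc outcomeMean p (fun o => Real.exp (s * stepDev p e d o))
      ≤ outcomeMean p (fun o => 1 + s * stepDev p e d o + s ^ 2 / 2 * stepDev p e d o ^ 2
          + 8 * s ^ 3) := by
        refine outcomeMean_mono hp hp1 fun o => ?_
        have habs : |s * stepDev p e d o| ≤ 2 * s := by
          rw [abs_mul, abs_of_nonneg hs]
          nlinarith [abs_stepDev_le hp hp1 e d o]
        have hcube : |s * stepDev p e d o| ^ 3 ≤ (2 * s) ^ 3 := by gcongr
        nlinarith [exp_le_one_add_sq_add_cube (habs.trans (by linarith))]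
    _ = 1 + s * outcomeMean p (stepDev p e d) + s ^ 2 / 2 * stepVar p e d + 8 * s ^ 3 := by
        simp only [stepVar, outcomeMean_eq]; ring
    _ = s ^ 2 * (stepVar p e d / 2 + 8 * s) + 1 := by rw [outcomeMean_stepDev]; ring
    _ ≤ _ := Real.add_one_le_exp _

lemma wordMean_exp_le (hp : 0 ≤ p) (hp1 : p ≤ 1) (hs : 0 ≤ s) (hs1 : s ≤ 1 / 2) (e : Dir)
    (l : List Dir) :
    wordMean p l.length (fun w => Real.exp (s * (e.comp (agentDisp l w) -
        (1 - p) * e.comp (displacement l)))) ≤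
      Real.exp (s ^ 2 * ((l.map (stepVar p e)).sum / 2 + 8 * s * l.length)) := by
  induction l with
  | nil => simp [wordMean, agentDisp, displacement, Dir.comp]
  | cons d l ih =>
    have hsplit (o : Outcome) (w : List Outcome) :
        Real.exp (s * (e.comp (agentDisp (d :: l) (o :: w)) -
          (1 - p) * e.comp (displacement (d :: l)))) = Real.exp (s * stepDev p e d o) *
        Real.exp (s * (e.comp (agentDisp l w) - (1 - p) * e.comp (displacement l))) := by
      rw [← Real.exp_add, agentDisp_cons, displacement_cons, Dir.comp_add, Dir.comp_add, stepDev]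
      push_cast
      ring_nf
    simp only [List.length_cons, wordMean, hsplit, wordMean_mul_left]
    simp only [mul_comm (Real.exp (s * stepDev p e d _)), outcomeMean_mul_left]
    calc _ ≤ Real.exp (s ^ 2 * ((l.map (stepVar p e)).sum / 2 + 8 * s * l.length)) *
          Real.exp (s ^ 2 * (stepVar p e d / 2 + 8 * s)) := by
          refine mul_le_mul ih (outcomeMean_exp_le hp hp1 hs hs1 e d) ?_ (Real.exp_pos _).le
          exact (outcomeMean_const p 0).ge.trans (outcomeMean_mono hp hp1 fun o =>
            (Real.exp_pos _).le)
      _ = _ := by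
          rw [← Real.exp_add]
          simp only [List.map_cons, List.sum_cons]
          push_cast
          ring_nf

lemma wordMean_exp_le_of_stepVar_le_one (hp : 0 ≤ p) (hp1 : p ≤ 1) (hs : 0 ≤ s)
    (hs1 : s ≤ 1 / 2) (e : Dir) (l : List Dir) :
    wordMean p l.length (fun w => Real.exp (s * (e.comp (agentDisp l w) -
        (1 - p) * e.comp (displacement l)))) ≤ Real.exp (5 * s ^ 2 * l.length) := by
  refine (wordMean_exp_le hp hp1 hs hs1 e l).trans (Real.exp_le_exp.mpr ?_)
  have hvar : (l.map (stepVar p e)).sum ≤ l.length := by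
    simpa using (l.map (stepVar p e)).sum_le_card_nsmul 1 (by simp [stepVar_le_one hp hp1])
  calc s ^ 2 * ((l.map (stepVar p e)).sum / 2 + 8 * s * l.length)
      ≤ s ^ 2 * (5 * l.length) := by gcongr; nlinarith [Nat.cast_nonneg (α := ℝ) l.length]
    _ = _ := by ring

end Moment

/-- The agent with outcomes `w` always stays within `δ` of `m` times the instructions `l`, in both
coordinates (each sign of a coordinate is a direction `e`). With `m = 1 - p` the latter is its mean
position. -/
def StaysClose (m δ : ℝ) (l : List Dir) (w : List Outcome) : Prop :=
  ∀ k ≤ l.length, ∀ e : Dir,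
    e.comp (agentDisp (l.take k) w) - m * e.comp (displacement (l.take k)) ≤ δ

lemma one_sub_le_wordProb_staysClose {p s : ℝ} (hp : 0 ≤ p) (hp1 : p ≤ 1) (hs : 0 ≤ s)
    (hs1 : s ≤ 1 / 2) (δ : ℝ) (l : List Dir) :
    1 - 4 * (l.length + 1) * Real.exp (-s * δ + 5 * s ^ 2 * l.length) ≤
      wordProb p l.length {w | StaysClose (1 - p) δ l w} := by
  let dev (k : ℕ) (e : Dir) (w : List Outcome) : ℝ :=
    e.comp (agentDisp (l.take k) w) - (1 - p) * e.comp (displacement (l.take k))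
  have hmean : ∀ i ∈ Finset.range (l.length + 1) ×ˢ (Finset.univ : Finset Dir),
      wordMean p l.length (fun w => Real.exp (s * (dev i.1 i.2 w - δ))) ≤
        Real.exp (-s * δ + 5 * s ^ 2 * l.length) := by
    rintro ⟨k, e⟩ hi
    have hk : k ≤ l.length := by
      simpa [Nat.lt_succ_iff] using (Finset.mem_product.mp hi).1
    have hlen : (l.take k).length = k := by simpa using hk
    have hexp := wordMean_exp_le_of_stepVar_le_one hp hp1 hs hs1 e (l.take k)
    rw [hlen] at hexp
    calc wordMean p l.length (fun w => Real.exp (s * (dev k e w - δ)))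
        = Real.exp (-s * δ) * wordMean p k (fun w => Real.exp (s * dev k e w)) := by
          rw [← wordMean_take hk, ← wordMean_mul_left]
          refine wordMean_congr fun w _ => ?_
          simp only [dev, agentDisp_take_right w hlen.le]
          rw [← Real.exp_add]
          ring_nf
      _ ≤ Real.exp (-s * δ) * Real.exp (5 * s ^ 2 * l.length) := by
          refine mul_le_mul_of_nonneg_left (hexp.trans (Real.exp_le_exp.mpr ?_)) (Real.exp_pos _).le
          gcongr
      _ = _ := (Real.exp_add _ _).symm
  calc 1 - 4 * (l.length + 1) * Real.exp (-s * δ + 5 * s ^ 2 * l.length)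
      ≤ 1 - ∑ i ∈ Finset.range (l.length + 1) ×ˢ (Finset.univ : Finset Dir),
          wordMean p l.length (fun w => Real.exp (s * (dev i.1 i.2 w - δ))) := by
        have hsum := Finset.sum_le_card_nsmul _ _ _ hmean
        rw [Finset.card_product, Finset.card_range,
          show (Finset.univ : Finset Dir).card = 4 from rfl, nsmul_eq_mul] at hsum
        push_cast at hsum
        linarith
    _ ≤ _ := by
        refine one_sub_sum_le_wordProb hp hp1 _ (fun i _ w => (Real.exp_pos _).le) fun w _ hw => ?_
        simp only [StaysClose, Set.mem_ofPred_eq, not_forall, not_le] at hw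
        obtain ⟨k, hk, e, hke⟩ := hw
        exact ⟨(k, e), by simpa [Nat.lt_succ_iff] using hk,
          Real.one_le_exp (mul_nonneg hs (sub_nonneg.mpr hke.le))⟩

/-! ### Crossing lattice paths -/

/-- The first `n` steps of `f` are steps of a nearest-neighbour path. -/
def IsLatticePath (f : ℕ → ℤ × ℤ) (n : ℕ) : Prop := ∀ i < n, ∃ d : Dir, f (i + 1) = f i + d.vec

/-- The signed number of crossings of the half-line `(0, ∞) × {1 / 2}` by the lattice edge
from `u` to `v`. -/
def edgeCrossing (u v : ℤ × ℤ) : ℤ :=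
  if 0 < u.1 ∧ 0 < v.1 then (if 1 ≤ v.2 then 1 else 0) - (if 1 ≤ u.2 then 1 else 0) else 0

/-- The signed number of crossings of the half-line `(0, ∞) × {1 / 2}` by the first `n` steps
of a path. -/
def pathCrossing (f : ℕ → ℤ × ℤ) (n : ℕ) : ℤ := ∑ i ∈ Finset.range n, edgeCrossing (f i) (f (i + 1))

lemma Dir.exists_vec_eq_neg (d : Dir) : ∃ d' : Dir, d'.vec = -d.vec := by
  cases d
  exacts [⟨.west, rfl⟩, ⟨.east, rfl⟩, ⟨.south, rfl⟩, ⟨.north, rfl⟩]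

lemma IsLatticePath.add_const {f : ℕ → ℤ × ℤ} {n : ℕ} (hf : IsLatticePath f n) (v : ℤ × ℤ) :
    IsLatticePath (fun i => f i + v) n := fun i hi => by
  obtain ⟨d, hd⟩ := hf i hi
  exact ⟨d, by simp only [hd]; abel⟩

lemma IsLatticePath.reverse {f : ℕ → ℤ × ℤ} {n : ℕ} (hf : IsLatticePath f n) :
    IsLatticePath (fun i => f (n - i)) n := fun i hi => by
  obtain ⟨d, hd⟩ := hf (n - (i + 1)) (by omega)
  obtain ⟨d', hd'⟩ := d.exists_vec_eq_neg
  exact ⟨d', by beta_reduce; rw [show n - i = n - (i + 1) + 1 by omega, hd, hd']; abel⟩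

lemma edgeCrossing_square (u : ℤ × ℤ) (d e : Dir) (h₀ : u ≠ 0) (h₁ : u + d.vec ≠ 0)
    (h₂ : u + e.vec ≠ 0) (h₃ : u + d.vec + e.vec ≠ 0) :
    edgeCrossing u (u + d.vec) + edgeCrossing (u + d.vec) (u + d.vec + e.vec) =
      edgeCrossing u (u + e.vec) + edgeCrossing (u + e.vec) (u + d.vec + e.vec) := by
  obtain ⟨x, y⟩ := u
  simp only [ne_eq, Prod.ext_iff, Prod.fst_add, Prod.snd_add, Prod.fst_zero, Prod.snd_zero]
    at h₀ h₁ h₂ h₃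
  cases d <;> cases e <;>
    simp only [edgeCrossing, Dir.vec, Prod.fst_add, Prod.snd_add] at * <;> grind

lemma edgeCrossing_eq_zero_of_same_side {u v : ℤ × ℤ} (h : 1 ≤ u.2 ↔ 1 ≤ v.2) :
    edgeCrossing u v = 0 := by
  simp only [edgeCrossing, h, sub_self, ite_self]

lemma pathCrossing_eq_zero_of_fst_neg {f : ℕ → ℤ × ℤ} {n : ℕ} (h : ∀ i ≤ n, (f i).1 < 0) :
    pathCrossing f n = 0 :=
  Finset.sum_eq_zero fun i hi => if_neg fun hpos =>
    hpos.1.not_gt (h i (Finset.mem_range.mp hi).le)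

lemma pathCrossing_eq_one_of_fst_pos {f : ℕ → ℤ × ℤ} {n : ℕ} (h : ∀ i ≤ n, 0 < (f i).1)
    (h0 : (f 0).2 < 0) (hn : 0 < (f n).2) : pathCrossing f n = 1 := by
  have hedge : ∀ i ∈ Finset.range n, edgeCrossing (f i) (f (i + 1)) =
      (if 1 ≤ (f (i + 1)).2 then 1 else 0) - (if 1 ≤ (f i).2 then 1 else 0) := fun i hi =>
    have hi := Finset.mem_range.mp hi
    if_pos ⟨h i hi.le, h (i + 1) hi⟩
  rw [pathCrossing, Finset.sum_congr rfl hedge,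
    Finset.sum_range_sub (fun i => if 1 ≤ (f i).2 then (1 : ℤ) else 0),
    if_pos (by omega), if_neg (by omega), sub_zero]

lemma pathCrossing_add_vec {f : ℕ → ℤ × ℤ} {n : ℕ} (hf : IsLatticePath f n) (d : Dir)
    (hne : ∀ i ≤ n, f i ≠ 0) (hne' : ∀ i ≤ n, f i + d.vec ≠ 0)
    (h0 : (f 0).2 < 0) (h0' : (f 0 + d.vec).2 < 0)
    (hn : 0 < (f n).2) (hn' : 0 < (f n + d.vec).2) :
    pathCrossing (fun i => f i + d.vec) n = pathCrossing f n := by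
  have hsquare : ∀ i ∈ Finset.range n,
      edgeCrossing (f i + d.vec) (f (i + 1) + d.vec) - edgeCrossing (f i) (f (i + 1)) =
        edgeCrossing (f (i + 1)) (f (i + 1) + d.vec) - edgeCrossing (f i) (f i + d.vec) := by
    intro i hi
    rw [Finset.mem_range] at hi
    obtain ⟨e, he⟩ := hf i hi
    have hcomm : f i + e.vec + d.vec = f i + d.vec + e.vec := by abel
    have h2 := hne (i + 1) hi
    have h3 := hne' (i + 1) hi
    rw [he] at h2 h3 ⊢
    rw [hcomm] at h3 ⊢
    linarith [edgeCrossing_square (f i) d e (hne i hi.le) (hne' i hi.le) h2 h3]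
  have hsum := Finset.sum_congr rfl hsquare
  rw [Finset.sum_sub_distrib, Finset.sum_range_sub (fun i => edgeCrossing (f i) (f i + d.vec)),
    edgeCrossing_eq_zero_of_same_side (by omega), edgeCrossing_eq_zero_of_same_side (by omega),
    sub_zero] at hsum
  exact sub_eq_zero.mp hsum

/-- A discrete form of the fact that a path from left to right and a path from top to bottom of a
rectangle meet: `a i + b j = 0` says that `a` meets `-b`. Otherwise the paths `b + a i` would all
cross the half-line `(0, ∞) × {1 / 2}` equally often, although `b + a 0` does not meet it and
`b + a m` crosses it once. -/
lemma exists_add_eq_zero_of_crossing {m n : ℕ} {a b : ℕ → ℤ × ℤ}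
    (ha : IsLatticePath a m) (hb : IsLatticePath b n)
    (hleft : ∀ j ≤ n, (a 0 + b j).1 < 0) (hright : ∀ j ≤ n, 0 < (a m + b j).1)
    (hbot : ∀ i ≤ m, (a i + b 0).2 < 0) (htop : ∀ i ≤ m, 0 < (a i + b n).2) :
    ∃ i ≤ m, ∃ j ≤ n, a i + b j = 0 := by
  by_contra! hne
  have hzero : ∀ i ≤ m, pathCrossing (fun j => a i + b j) n = 0 := by
    intro i
    induction i with
    | zero => exact fun _ => pathCrossing_eq_zero_of_fst_neg hleft
    | succ i ih =>
      intro hi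
      obtain ⟨d, hd⟩ := ha i hi
      have hshift : ∀ j, a (i + 1) + b j = a i + b j + d.vec := fun j => by rw [hd]; abel
      have hpath : IsLatticePath (fun j => a i + b j) n := by
        simpa only [add_comm] using hb.add_const (a i)
      simp only [hshift]
      rw [← ih (by omega)]
      refine pathCrossing_add_vec hpath d (hne i (by omega)) (fun j hj => ?_) (hbot i (by omega))
        ?_ (htop i (by omega)) ?_
      · exact hshift j ▸ hne (i + 1) hi j hj
      · exact hshift 0 ▸ hbot (i + 1) hi
      · exact hshift n ▸ htop (i + 1) hi
  have hone := pathCrossing_eq_one_of_fst_pos hright (hbot m le_rfl) (htop m le_rfl)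
  exact zero_ne_one ((hzero m le_rfl).symm.trans hone)

/-! ### The geometry of a sweep -/

/-- The moves of a sweep with shift `z` up to its first horizontal line. -/
def approach (w h z : ℕ) : List Dir :=
  List.replicate w .west ++ List.replicate h .south ++ List.replicate z .north

/-- The number of moves of a zigzag with lines of length `2 * w` and gaps `g` until it is on line
`k` at distance `i` from the western end of that line. -/
def lineTime (w g k i : ℕ) : ℕ := k * (2 * w + g) + if Even k then i else 2 * w - i

lemma length_approach (w h z : ℕ) : (approach w h z).length = w + h + z := by
  simp only [approach, List.length_append, List.length_replicate]

lemma displacement_approach (w h z : ℕ) :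
    displacement (approach w h z) = (-(w : ℤ), (z : ℤ) - h) := by
  simp only [approach, displacement_append, displacement_replicate, Dir.vec]
  ext <;> simp
  ring

lemma take_approach (w h : ℕ) {M z : ℕ} (hz : z ≤ M) :
    (approach w h M).take (w + h + z) = approach w h z := by
  have hlen : (List.replicate w Dir.west ++ List.replicate h Dir.south).length = w + h := by simp
  rw [approach, ← hlen, List.take_length_add_append, List.take_replicate, min_eq_left hz, approach]

lemma length_zigzag_succ (w g n : ℕ) :
    (zigzag w g (n + 1)).length = n * (2 * w + g) + 2 * w := by
  induction n with
  | zero => simp [zigzag]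
  | succ n ih =>
    rw [zigzag, List.length_append, List.length_append, ih, if_neg n.succ_ne_zero,
      List.length_replicate, List.length_replicate]
    ring

lemma length_zigzag_gap (w g n : ℕ) :
    (zigzag w g n ++ (if n = 0 then [] else List.replicate g Dir.north)).length =
      n * (2 * w + g) := by
  cases n with
  | zero => simp [zigzag]
  | succ n =>
    rw [List.length_append, length_zigzag_succ, if_neg n.succ_ne_zero, List.length_replicate]
    ring

lemma displacement_zigzag_gap (w g n : ℕ) :
    displacement (zigzag w g n ++ (if n = 0 then [] else List.replicate g Dir.north)) =
      (if Even n then 0 else 2 * (w : ℤ), n * (g : ℤ)) := by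
  induction n with
  | zero => simp [zigzag, displacement, Prod.zero_eq_mk]
  | succ n ih =>
    rw [zigzag, displacement_append, displacement_append, ih, displacement_replicate,
      if_neg n.succ_ne_zero, displacement_replicate]
    ext
    · by_cases hn : Even n <;> simp [hn, Nat.even_add_one, Dir.vec]
    · by_cases hn : Even n <;> simp [hn, Dir.vec] <;> ring

lemma displacement_take_zigzag (w g : ℕ) {n k j : ℕ} (hk : k < n) (hj : j ≤ 2 * w) :
    displacement ((zigzag w g n).take (k * (2 * w + g) + j)) =
      (if Even k then (j : ℤ) else 2 * w - j, k * (g : ℤ)) := by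
  induction n, hk using Nat.le_induction with
  | base =>
    rw [zigzag, ← length_zigzag_gap, List.take_length_add_append, displacement_append,
      displacement_zigzag_gap, List.take_replicate, displacement_replicate, min_eq_left hj]
    split_ifs <;> simp [Dir.vec, sub_eq_add_neg]
  | succ n hkn ih =>
    have hle : k * (2 * w + g) + j ≤ (zigzag w g n).length := by
      obtain ⟨n, rfl⟩ := Nat.exists_eq_add_of_le' (Nat.zero_lt_of_lt hkn)
      rw [length_zigzag_succ]
      have := Nat.mul_le_mul_right (2 * w + g) (Nat.le_of_lt_succ hkn)
      omega
    rw [zigzag, List.append_assoc, List.take_append_of_le_length hle, ih]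

lemma displacement_take_lineTime (w g : ℕ) {n k i : ℕ} (hk : k < n) (hi : i ≤ 2 * w) :
    displacement ((zigzag w g n).take (lineTime w g k i)) = ((i : ℤ), k * (g : ℤ)) := by
  rw [lineTime, displacement_take_zigzag w g hk (by split_ifs <;> omega)]
  split_ifs
  · rfl
  · rw [Nat.cast_sub hi]; push_cast; rw [sub_sub_cancel]

lemma lineTime_le_length (w g : ℕ) {n k i : ℕ} (hk : k < n) (hi : i ≤ 2 * w) :
    lineTime w g k i ≤ (zigzag w g n).length := by
  obtain ⟨n, rfl⟩ := Nat.exists_eq_add_of_le' (Nat.zero_lt_of_lt hk)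
  have := Nat.mul_le_mul_right (2 * w + g) (Nat.le_of_lt_succ hk)
  rw [length_zigzag_succ, lineTime]
  split_ifs <;> omega

/-! ### Agents that stay close to their mean position -/

section Close

variable {m δ : ℝ} {l : List Dir} {u : List Outcome}

lemma StaysClose.abs_sub_le (h : StaysClose m δ l u) {k : ℕ} (hk : k ≤ l.length) :
    |((agentDisp (l.take k) u).1 : ℝ) - m * (displacement (l.take k)).1| ≤ δ ∧
      |((agentDisp (l.take k) u).2 : ℝ) - m * (displacement (l.take k)).2| ≤ δ := by
  have hE := h k hk .east
  have hW := h k hk .west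
  have hN := h k hk .north
  have hS := h k hk .south
  simp only [Dir.comp, Dir.vec, one_mul, zero_mul, neg_mul, add_zero, zero_add, Int.cast_neg,
    mul_neg] at hE hW hN hS
  exact ⟨abs_le.mpr ⟨by linarith, by linarith⟩, abs_le.mpr ⟨by linarith, by linarith⟩⟩

lemma StaysClose.nonneg (h : StaysClose m δ l u) : 0 ≤ δ :=
  (abs_nonneg _).trans (h.abs_sub_le (Nat.zero_le _)).1

lemma StaysClose.mono (h : StaysClose m δ l u) {δ' : ℝ} (hδ : δ ≤ δ') : StaysClose m δ' l u :=
  fun k hk e => (h k hk e).trans hδ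

lemma StaysClose.of_append {l' : List Dir} {u' : List Outcome} (hlen : l.length = u.length)
    (h : StaysClose m δ (l ++ l') (u ++ u')) :
    StaysClose m δ l u ∧ StaysClose m (2 * δ) l' u' := by
  have hleft : StaysClose m δ l u := fun k hk e => by
    have hclose := h k (hk.trans (by simp)) e
    rwa [List.take_append_of_le_length hk,
      agentDisp_append_right _ (by rw [List.length_take]; omega)] at hclose
  refine ⟨hleft, fun k hk e => ?_⟩
  obtain ⟨e', he'⟩ := e.exists_vec_eq_neg
  have hneg (v : ℤ × ℤ) : (e'.comp v : ℝ) = -e.comp v := by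
    simp only [Dir.comp, he', Prod.fst_neg, Prod.snd_neg]; push_cast; ring
  have hboth := h (l.length + k) (by simpa using hk) e
  have hrev := hleft l.length le_rfl e'
  rw [List.take_length_add_append, agentDisp_append hlen, displacement_append, Dir.comp_add,
    Dir.comp_add] at hboth
  rw [List.take_length, hneg, hneg] at hrev
  push_cast at hboth
  linarith

lemma isLatticePath_agentDisp_take (h : l.length ≤ u.length) :
    IsLatticePath (fun k => agentDisp (l.take k) u) l.length :=
  fun _ hk => exists_agentDisp_take_succ hk (hk.trans_le h)

lemma isLatticePath_agentDisp_approach {w h M : ℕ} (hu : w + h + M ≤ u.length) :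
    IsLatticePath (fun z => agentDisp (approach w h z) u) M := fun z hz => by
  simpa only [← take_approach w h hz, ← take_approach w h hz.le, add_assoc] using
    isLatticePath_agentDisp_take (l := approach w h M) (by rwa [length_approach]) (w + h + z)
      (by rw [length_approach]; omega)

lemma isLatticePath_agentDisp_line {w g n k : ℕ} (hk : k < n)
    (hu : (zigzag w g n).length ≤ u.length) :
    IsLatticePath (fun i => agentDisp ((zigzag w g n).take (lineTime w g k i)) u) (2 * w) := by
  have heast : IsLatticePath
      (fun i => agentDisp ((zigzag w g n).take (k * (2 * w + g) + i)) u) (2 * w) := fun i hi => by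
    refine isLatticePath_agentDisp_take hu (k * (2 * w + g) + i) ?_
    obtain ⟨n, rfl⟩ := Nat.exists_eq_add_of_le' (Nat.zero_lt_of_lt hk)
    have := Nat.mul_le_mul_right (2 * w + g) (Nat.le_of_lt_succ hk)
    rw [length_zigzag_succ]
    omega
  by_cases hev : Even k
  · simpa only [lineTime, if_pos hev] using heast
  · simpa only [lineTime, if_neg hev] using heast.reverse

lemma StaysClose.approach_bounds {w h M z : ℕ} (hu : StaysClose m δ (approach w h M) u)
    (hz : z ≤ M) :
    |((agentDisp (approach w h z) u).1 : ℝ) + m * w| ≤ δ ∧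
      |((agentDisp (approach w h z) u).2 : ℝ) - m * (z - h)| ≤ δ := by
  have hclose := hu.abs_sub_le (k := w + h + z) (by rw [length_approach]; omega)
  rw [take_approach w h hz, displacement_approach] at hclose
  push_cast at hclose
  rwa [mul_neg, sub_neg_eq_add] at hclose

lemma StaysClose.line_bounds {w g n k i : ℕ} (hu : StaysClose m δ (zigzag w g n) u) (hk : k < n)
    (hi : i ≤ 2 * w) :
    |((agentDisp ((zigzag w g n).take (lineTime w g k i)) u).1 : ℝ) - m * i| ≤ δ ∧
      |((agentDisp ((zigzag w g n).take (lineTime w g k i)) u).2 : ℝ) - m * (k * g)| ≤ δ := by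
  have hclose := hu.abs_sub_le (lineTime_le_length w g hk hi)
  rw [displacement_take_lineTime w g hk hi] at hclose
  exact_mod_cast hclose

lemma StaysClose.line_add_approach_bounds {w h g n k M i z : ℕ} {v : List Outcome} (y : ℤ × ℤ)
    (hu : StaysClose m δ (approach w h M) u) (hv : StaysClose m δ (zigzag w g n) v) (hk : k < n)
    (hi : i ≤ 2 * w) (hz : z ≤ M) :
    |(((agentDisp ((zigzag w g n).take (lineTime w g k i)) v +
        (agentDisp (approach w h z) u + y)).1 : ℤ) : ℝ) - (m * (i - w) + y.1)| ≤ 2 * δ ∧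
    |(((agentDisp ((zigzag w g n).take (lineTime w g k i)) v +
        (agentDisp (approach w h z) u + y)).2 : ℤ) : ℝ) - (m * (k * g + (z - h)) + y.2)| ≤
      2 * δ := by
  have hline := hv.line_bounds hk hi
  have happr := hu.approach_bounds hz
  simp only [Prod.fst_add, Prod.snd_add, Int.cast_add, abs_le] at hline happr ⊢
  refine ⟨⟨?_, ?_⟩, ?_, ?_⟩ <;> linarith

end Close

lemma exists_nat_lt_and_mul_lt_and_le {b c : ℝ} {n : ℕ} (hb : 0 < b) (hc : 0 < c)
    (hcn : c ≤ b * n) : ∃ k < n, b * k < c ∧ c ≤ b * (k + 1) := by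
  obtain ⟨k, hk⟩ := Nat.exists_eq_add_of_le' (Nat.ceil_pos.mpr (div_pos hc hb))
  have hlt : (k : ℝ) < c / b := Nat.lt_ceil.mp (by omega)
  have hle : c / b ≤ (k + 1 : ℕ) := Nat.ceil_le.mp hk.le
  rw [lt_div_iff₀ hb, mul_comm] at hlt
  rw [div_le_iff₀ hb, mul_comm] at hle
  refine ⟨k, ?_, hlt, by exact_mod_cast hle⟩
  exact_mod_cast lt_of_mul_lt_mul_left (hlt.trans_le hcn) hb.le

/-- The agent that starts at `x` and is given the instructions `l` visits `home`. -/
def Hits (x home : ℤ × ℤ) (l : List Dir) (w : List Outcome) : Prop :=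
  ∃ k ≤ l.length, x + agentDisp (l.take k) w = home

/-- As the shift `z` varies, the starting point of the lines moves north along a lattice path. The
line `k` is chosen such that, seen from that path, it passes south of the target for `z = 0` and
north of it for `z = M`, and so it has to meet the target for some `z`. -/
lemma exists_shift_hit {w h g n M : ℕ} {m δ : ℝ} {x home : ℤ × ℤ} {u v : List Outcome}
    (hm : 0 < m) (hg : 0 < g) (hu : u.length = w + h + M) (hv : v.length = (zigzag w g n).length)
    (hcu : StaysClose m δ (approach w h M) u) (hcv : StaysClose m δ (zigzag w g n) v)
    (hE : ((x - home).1 : ℝ) + 2 * δ < m * w) (hW : -((x - home).1 : ℝ) + 2 * δ < m * w)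
    (hN : ((x - home).2 : ℝ) + 2 * δ < m * h) (hS : -((x - home).2 : ℝ) ≤ m * h)
    (hn : 2 * h ≤ n * g) (hM : 4 * δ < m * (M - g)) :
    ∃ z ∈ Finset.Icc 1 M, Hits (x + agentDisp (approach w h z) u) home (zigzag w g n) v := by
  set y := x - home with hy
  have hδ := hcu.nonneg
  have hnR : 2 * (h : ℝ) ≤ n * g := by exact_mod_cast hn
  obtain ⟨k, hkn, hklt, hkle⟩ : ∃ k < n,
      m * g * k < m * h - y.2 - 2 * δ ∧ m * h - y.2 - 2 * δ ≤ m * g * (k + 1) :=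
    exists_nat_lt_and_mul_lt_and_le (by positivity) (by linarith) (by nlinarith)
  let line (i : ℕ) : ℤ × ℤ := agentDisp ((zigzag w g n).take (lineTime w g k i)) v
  let start (z : ℕ) : ℤ × ℤ := agentDisp (approach w h z) u + y
  have hpos {i z : ℕ} (hi : i ≤ 2 * w) (hz : z ≤ M) :=
    hcu.line_add_approach_bounds y hcv hkn hi hz
  have hbot : ∀ i ≤ 2 * w, (line i + start 0).2 < 0 := fun i hi => by
    have := (abs_le.mp (hpos hi M.zero_le).2).2
    rw [← Int.cast_lt (R := ℝ)]
    push_cast at this ⊢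
    linarith
  have htop : ∀ i ≤ 2 * w, 0 < (line i + start M).2 := fun i hi => by
    have := (abs_le.mp (hpos hi le_rfl).2).1
    rw [← Int.cast_lt (R := ℝ)]
    push_cast at this ⊢
    linarith
  have hleft : ∀ z ≤ M, (line 0 + start z).1 < 0 := fun z hz => by
    have := (abs_le.mp (hpos (2 * w).zero_le hz).1).2
    rw [← Int.cast_lt (R := ℝ)]
    push_cast at this ⊢
    linarith
  have hright : ∀ z ≤ M, 0 < (line (2 * w) + start z).1 := fun z hz => by
    have := (abs_le.mp (hpos le_rfl hz).1).1
    rw [← Int.cast_lt (R := ℝ)]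
    push_cast at this ⊢
    linarith
  obtain ⟨i, hi, z, hz, hmeet⟩ := exists_add_eq_zero_of_crossing
    (isLatticePath_agentDisp_line hkn hv.ge)
    ((isLatticePath_agentDisp_approach hu.ge).add_const y) hleft hright hbot htop
  have hz0 : z ≠ 0 := by
    rintro rfl
    exact (hbot i hi).ne (congrArg Prod.snd hmeet)
  refine ⟨z, Finset.mem_Icc.mpr ⟨Nat.one_le_iff_ne_zero.mpr hz0, hz⟩, lineTime w g k i,
    lineTime_le_length w g hkn hi, ?_⟩
  rw [← sub_eq_zero, ← hmeet, hy]
  abel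

/-! ### The probability of a visit during a sweep -/

section Hit

variable {p : ℝ} {x home : ℤ × ℤ}

lemma Hits.append_left {l₁ l₂ : List Dir} {u v : List Outcome} (hlen : l₁.length = u.length)
    (h : Hits (x + agentDisp l₁ u) home l₂ v) : Hits x home (l₁ ++ l₂) (u ++ v) := by
  obtain ⟨k, hk, hhome⟩ := h
  refine ⟨l₁.length + k, by simpa using hk, ?_⟩
  rw [List.take_length_add_append, agentDisp_append hlen, ← add_assoc, hhome]

lemma Hits.append_right {l : List Dir} {u : List Outcome} (hlen : l.length ≤ u.length)
    (h : Hits x home l u) (r : List Dir) (v : List Outcome) : Hits x home (l ++ r) (u ++ v) := by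
  obtain ⟨k, hk, hhome⟩ := h
  refine ⟨k, hk.trans (by simp), ?_⟩
  rwa [List.take_append_of_le_length hk,
    agentDisp_append_right v (by rw [List.length_take]; omega)]

lemma wordProb_append (m n : ℕ) (S : Set (List Outcome)) :
    wordProb p (m + n) S = wordMean p m fun u => wordProb p n {v | u ++ v ∈ S} :=
  wordMean_append m n _

lemma wordProb_le_wordProb_add (hp : 0 ≤ p) (hp1 : p ≤ 1) {m n : ℕ} {S T : Set (List Outcome)}
    (h : ∀ u v, u.length = m → u ∈ S → u ++ v ∈ T) : wordProb p m S ≤ wordProb p (m + n) T := by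
  rw [wordProb_append]
  refine wordMean_mono hp hp1 fun u hu => ?_
  rw [← wordMean_const (p := p) n (S.indicator 1 u)]
  refine wordMean_mono hp hp1 fun v _ => ?_
  by_cases hS : u ∈ S
  · have hT : v ∈ {v | u ++ v ∈ T} := h u v hu hS
    rw [Set.indicator_of_mem hS, Set.indicator_of_mem hT]
    exact le_rfl
  · rw [Set.indicator_of_notMem hS]
    exact Set.indicator_nonneg (fun _ _ => zero_le_one) v

lemma wordProb_le_sum (hp : 0 ≤ p) (hp1 : p ≤ 1) {ι : Type*} (I : Finset ι) {n : ℕ}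
    {S : Set (List Outcome)} {T : ι → Set (List Outcome)}
    (h : ∀ w, w.length = n → w ∈ S → ∃ i ∈ I, w ∈ T i) :
    wordProb p n S ≤ ∑ i ∈ I, wordProb p n (T i) := by
  have hpos (w : List Outcome) (i : ι) : 0 ≤ (T i).indicator (1 : List Outcome → ℝ) w :=
    Set.indicator_nonneg (fun _ _ => zero_le_one) w
  simp only [wordProb, ← wordMean_sum]
  refine wordMean_mono hp hp1 fun w hw => ?_
  by_cases hS : w ∈ S
  · obtain ⟨i, hi, hwi⟩ := h w hw hS
    refine le_of_eq_of_le ?_ (Finset.single_le_sum (fun i _ => hpos w i) hi)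
    rw [Set.indicator_of_mem hS, Set.indicator_of_mem hwi]
  · rw [Set.indicator_of_notMem hS]
    exact Finset.sum_nonneg fun i _ => hpos w i

lemma wordMean_wordProb_hits_le (hp : 0 ≤ p) (hp1 : p ≤ 1) (l₁ l₂ r : List Dir) :
    (wordMean p l₁.length fun u =>
        wordProb p l₂.length {v | Hits (x + agentDisp l₁ u) home l₂ v}) ≤
      wordProb p (l₁ ++ l₂ ++ r).length {w | Hits x home (l₁ ++ l₂ ++ r) w} := by
  simp only [List.length_append, List.append_assoc, wordProb_append]
  refine wordMean_mono hp hp1 fun u hu => ?_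
  rw [← wordProb_append]
  exact wordProb_le_wordProb_add hp hp1 fun v v' hv hhit =>
    (Hits.append_right hv.ge hhit r v').append_left hu.symm

lemma one_sub_le_sum_wordProb_hits (hp : 0 ≤ p) (hp1 : p < 1) {s δ : ℝ} (hs : 0 ≤ s)
    (hs1 : s ≤ 1 / 2) {w h g n M L : ℕ} (r : ℕ → List Dir) (hg : 0 < g)
    (hL : ∀ z ≤ M, (approach w h z ++ zigzag w g n ++ r z).length = L)
    (hE : ((x - home).1 : ℝ) + 4 * δ < (1 - p) * w)
    (hW : -((x - home).1 : ℝ) + 4 * δ < (1 - p) * w)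
    (hN : ((x - home).2 : ℝ) + 4 * δ < (1 - p) * h) (hS : -((x - home).2 : ℝ) ≤ (1 - p) * h)
    (hn : 2 * h ≤ n * g) (hM : 8 * δ < (1 - p) * (M - g)) :
    1 - 4 * (L + 1) * Real.exp (-s * δ + 5 * s ^ 2 * L) ≤
      ∑ z ∈ Finset.Icc 1 M,
        wordProb p L {ω | Hits x home (approach w h z ++ zigzag w g n ++ r z) ω} := by
  set Z := zigzag w g n
  have happ : (approach w h M ++ Z).length = w + h + M + Z.length := by
    rw [List.length_append, length_approach]
  have hlen : (w + h + M + Z.length : ℕ) ≤ L := by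
    rw [← hL M le_rfl, List.length_append, happ]
    exact Nat.le_add_right _ _
  calc 1 - 4 * (L + 1) * Real.exp (-s * δ + 5 * s ^ 2 * L)
      ≤ 1 - 4 * ((w + h + M + Z.length : ℕ) + 1) *
          Real.exp (-s * δ + 5 * s ^ 2 * (w + h + M + Z.length : ℕ)) := by gcongr
    _ ≤ wordProb p (w + h + M + Z.length) {ω | StaysClose (1 - p) δ (approach w h M ++ Z) ω} := by
        simpa only [happ] using
          one_sub_le_wordProb_staysClose hp hp1.le hs hs1 δ (approach w h M ++ Z)
    _ ≤ wordMean p (w + h + M) fun u => ∑ z ∈ Finset.Icc 1 M,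
          wordProb p Z.length {v | Hits (x + agentDisp (approach w h z) u) home Z v} := by
        rw [wordProb_append]
        refine wordMean_mono hp hp1.le fun u hu => wordProb_le_sum hp hp1.le _ fun v hv hclose => ?_
        obtain ⟨hcu, hcv⟩ := StaysClose.of_append (by rw [length_approach, hu]) hclose
        have hδ := hcu.nonneg
        exact exists_shift_hit (δ := 2 * δ) (sub_pos.mpr hp1) hg hu hv (hcu.mono (by linarith)) hcv
          (by linarith) (by linarith) (by linarith) hS hn (by linarith)
    _ = ∑ z ∈ Finset.Icc 1 M, wordMean p (w + h + M) fun u =>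
          wordProb p Z.length {v | Hits (x + agentDisp (approach w h z) u) home Z v} :=
        wordMean_sum _ _ _
    _ ≤ _ := Finset.sum_le_sum fun z hz => ?_
  have hzM := (Finset.mem_Icc.mp hz).2
  rw [← hL z hzM]
  refine le_of_eq_of_le ?_ (wordMean_wordProb_hits_le hp hp1.le (approach w h z) Z (r z))
  rw [length_approach, ← wordMean_take (by omega : w + h + z ≤ w + h + M)]
  refine wordMean_congr fun u _ => ?_
  rw [agentDisp_take_right u (length_approach w h z).le]

end Hit

/-! ### The length of a phase and its vertical moves -/

/-- The number of moves of `l` to the north or to the south. -/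
def verticalCount (l : List Dir) : ℕ := l.countP (·.Vertical)

lemma verticalCount_append (l₁ l₂ : List Dir) :
    verticalCount (l₁ ++ l₂) = verticalCount l₁ + verticalCount l₂ := List.countP_append ..

lemma verticalCount_replicate (k : ℕ) (d : Dir) :
    verticalCount (List.replicate k d) = if d.Vertical then k else 0 := by
  simp only [verticalCount, List.countP_replicate, decide_eq_true_eq]

lemma verticalCount_replicate_le (k : ℕ) (d : Dir) :
    verticalCount (List.replicate k d) ≤ k :=
  List.countP_le_length.trans_eq (List.length_replicate ..)

lemma natAbs_displacement_snd_le (l : List Dir) :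
    (displacement l).2.natAbs ≤ verticalCount l := by
  induction l with
  | nil => simp [displacement]
  | cons d l ih =>
    rw [displacement_cons, ← List.singleton_append, verticalCount_append]
    have hd : d.vec.2.natAbs ≤ verticalCount [d] := by cases d <;> decide
    exact (Int.natAbs_add_le _ _).trans (Nat.add_le_add hd ih)

lemma verticalCount_zigzag_le (w g n : ℕ) : verticalCount (zigzag w g n) ≤ n * g := by
  induction n with
  | zero => simp [zigzag, verticalCount]
  | succ n ih =>
    have hgap : verticalCount (if n = 0 then [] else List.replicate g Dir.north) ≤ g := by
      split_ifs
      · exact Nat.zero_le _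
      · exact verticalCount_replicate_le _ _
    have hline : verticalCount (List.replicate (2 * w) (if Even n then Dir.east else Dir.west)) =
        0 := by
      rw [verticalCount_replicate, if_neg (by split_ifs <;> decide)]
    rw [zigzag, verticalCount_append, verticalCount_append, hline, add_mul]
    omega

lemma length_zigzag_le (w g n : ℕ) : (zigzag w g n).length ≤ 2 * w * n + n * g := by
  rcases n with _ | n
  · simp [zigzag]
  · rw [length_zigzag_succ]; nlinarith

lemma le_length_zigzag (w g n : ℕ) : 2 * w * n ≤ (zigzag w g n).length := by
  rcases n with _ | n
  · simp
  · rw [length_zigzag_succ]; nlinarith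

lemma displacement_zigzag_fst (w g n : ℕ) :
    (displacement (zigzag w g n)).1 = if Even n then 0 else 2 * (w : ℤ) := by
  have hgap : (displacement (if n = 0 then [] else List.replicate g Dir.north)).1 = 0 := by
    split_ifs
    · rfl
    · simp [displacement_replicate, Dir.vec]
  have hdisp := congrArg Prod.fst (displacement_zigzag_gap w g n)
  rwa [displacement_append, Prod.fst_add, hgap, add_zero] at hdisp

lemma displacement_straight (v : ℤ × ℤ) : displacement (straight v) = v := by
  have hrep (n : ℤ) (d d' : Dir) (hd : d'.vec = -d.vec) :
      n.natAbs • (if 0 ≤ n then d else d').vec = n • d.vec := by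
    split_ifs with hn
    · rw [← natCast_zsmul, Int.natAbs_of_nonneg hn]
    · rw [hd, ← natCast_zsmul, Int.ofNat_natAbs_of_nonpos (not_le.mp hn).le, smul_neg, neg_smul,
        neg_neg]
  rw [straight, displacement_append, displacement_replicate, displacement_replicate,
    hrep _ .east .west rfl, hrep _ .north .south rfl]
  simp [Dir.vec]

lemma sum_stepVar_vertical_le {p : ℝ} (hp : 0 ≤ p) (hp1 : p ≤ 1) {e : Dir} (he : e.Vertical)
    (l : List Dir) : (l.map (stepVar p e)).sum ≤ p / 2 * l.length + verticalCount l := by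
  induction l with
  | nil => simp [verticalCount]
  | cons d l ih =>
    rw [← List.singleton_append, verticalCount_append, List.singleton_append, List.map_cons,
      List.sum_cons, List.length_cons]
    have hcount : verticalCount [d] = if d.Vertical then 1 else 0 := verticalCount_replicate 1 d
    rw [hcount]
    push_cast
    by_cases hd : d.Vertical
    · have hvar := stepVar_le_one hp hp1 e d
      rw [if_pos hd]
      linarith
    · have hvar := stepVar_eq p e d
      rw [if_neg (by tauto)] at hvar
      rw [if_neg hd]
      linarith

section Phase

variable (p₀ A B : ℝ) (t z : ℕ)

lemma phase_eq_approach_append : phase p₀ A B t z =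
    approach (boxW p₀ A t) (boxH p₀ B t) z ++
      zigzag (boxW p₀ A t) (gap p₀ t) (numLines p₀ B t) ++
      (List.replicate (maxShift p₀ t - z) Dir.north ++
        straight (-displacement (sweep p₀ A B t z))) := by
  rw [phase, sweep, ← approach, List.append_assoc]

lemma displacement_phase : displacement (phase p₀ A B t z) = 0 := by
  rw [phase, displacement_append, displacement_straight, add_neg_cancel]

lemma natAbs_displacement_sweep_fst :
    (displacement (sweep p₀ A B t z)).1.natAbs = boxW p₀ A t := by
  simp only [sweep, displacement_append, displacement_replicate, Prod.fst_add,
    displacement_zigzag_fst, Dir.vec]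
  split_ifs <;> simp
  omega

variable {t z}

lemma verticalCount_sweep_le (hz : z ≤ maxShift p₀ t) :
    verticalCount (sweep p₀ A B t z) ≤
      boxH p₀ B t + maxShift p₀ t + numLines p₀ B t * gap p₀ t := by
  have hzigzag := verticalCount_zigzag_le (boxW p₀ A t) (gap p₀ t) (numLines p₀ B t)
  simp only [sweep, verticalCount_append, verticalCount_replicate, Dir.Vertical, reduceCtorEq,
    or_self, or_true, true_or, if_true, if_false]
  omega

lemma verticalCount_phase_le (hz : z ≤ maxShift p₀ t) :
    verticalCount (phase p₀ A B t z) ≤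
      2 * (boxH p₀ B t + maxShift p₀ t + numLines p₀ B t * gap p₀ t) := by
  have hsweep := verticalCount_sweep_le p₀ A B hz
  have hreturn : verticalCount (straight (-displacement (sweep p₀ A B t z))) ≤
      verticalCount (sweep p₀ A B t z) := by
    rw [straight, verticalCount_append, verticalCount_replicate,
      if_neg (by split_ifs <;> decide), zero_add, Prod.snd_neg, Int.natAbs_neg]
    exact (verticalCount_replicate_le _ _).trans (natAbs_displacement_snd_le _)
  rw [phase, verticalCount_append]
  omega

variable (t)

lemma phaseLength_le : phaseLength p₀ A B t ≤
    2 * boxW p₀ A t * numLines p₀ B t + (2 * boxW p₀ A t +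
      2 * (boxH p₀ B t + maxShift p₀ t + numLines p₀ B t * gap p₀ t)) := by
  have hsweep := verticalCount_sweep_le p₀ A B (Nat.zero_le (maxShift p₀ t))
  have hreturn := natAbs_displacement_snd_le (sweep p₀ A B t 0)
  have hzigzag := length_zigzag_le (boxW p₀ A t) (gap p₀ t) (numLines p₀ B t)
  rw [phaseLength, phase, List.length_append, straight, List.length_append,
    List.length_replicate, List.length_replicate, Prod.fst_neg, Prod.snd_neg, Int.natAbs_neg,
    Int.natAbs_neg, natAbs_displacement_sweep_fst]
  simp only [sweep, List.length_append, List.length_replicate] at *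
  omega

lemma le_phaseLength : 2 * boxW p₀ A t * numLines p₀ B t ≤ phaseLength p₀ A B t := by
  have hzigzag := le_length_zigzag (boxW p₀ A t) (gap p₀ t) (numLines p₀ B t)
  simp only [phaseLength, phase, sweep, List.length_append, List.length_replicate]
  omega

end Phase

/-! ### Asymptotics of the parameters of a phase -/

lemma tendsto_sqrt_natCast : Tendsto (fun t : ℕ => √(t : ℝ)) atTop atTop :=
  Real.tendsto_sqrt_atTop.comp tendsto_natCast_atTop_atTop

lemma tendsto_log_natCast : Tendsto (fun t : ℕ => Real.log t) atTop atTop :=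
  Real.tendsto_log_atTop.comp tendsto_natCast_atTop_atTop

lemma tendsto_rpow_natCast {r : ℝ} (hr : 0 < r) :
    Tendsto (fun t : ℕ => (t : ℝ) ^ r) atTop atTop :=
  (tendsto_rpow_atTop hr).comp tendsto_natCast_atTop_atTop

lemma tendsto_log_div_rpow {r : ℝ} (hr : 0 < r) :
    Tendsto (fun t : ℕ => Real.log t / (t : ℝ) ^ r) atTop (nhds 0) :=
  ((isLittleO_log_rpow_atTop hr).tendsto_div_nhds_zero).comp tendsto_natCast_atTop_atTop

lemma tendsto_log_div_sqrt :
    Tendsto (fun t : ℕ => Real.log t / √(t : ℝ)) atTop (nhds 0) := by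
  simpa only [Real.sqrt_eq_rpow] using tendsto_log_div_rpow (r := 1 / 2) (by norm_num)

lemma tendsto_one_div_log : Tendsto (fun t : ℕ => 1 / Real.log t) atTop (nhds 0) :=
  tendsto_log_natCast.const_div_atTop 1

lemma eventually_sqrt_log_pos :
    ∀ᶠ t : ℕ in atTop, 0 < √(t : ℝ) ∧ 0 < Real.log t ∧ (0 : ℝ) < t := by
  filter_upwards [tendsto_sqrt_natCast.eventually_gt_atTop 0,
    tendsto_log_natCast.eventually_gt_atTop 0,
    eventually_gt_atTop 0] with t hsqrt hlog ht
  exact ⟨hsqrt, hlog, Nat.cast_pos.mpr ht⟩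

lemma tendsto_sqrt_div_log :
    Tendsto (fun t : ℕ => √(t : ℝ) / Real.log t) atTop atTop := by
  have hpos : ∀ᶠ t : ℕ in atTop, Real.log t / √(t : ℝ) ∈ Set.Ioi 0 := by
    filter_upwards [eventually_sqrt_log_pos] with t ⟨hsqrt, hlog, _⟩
    exact div_pos hlog hsqrt
  simpa only [Pi.inv_def, inv_div] using
    (tendsto_nhdsWithin_iff.mpr ⟨tendsto_log_div_sqrt, hpos⟩).inv_tendsto_nhdsGT_zero

lemma tendsto_exp_log_sub_rpow (C : ℝ) {c r : ℝ} (hc : 0 < c) (hr : 0 < r) :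
    Tendsto (fun t : ℕ => Real.exp (C * Real.log t - c * (t : ℝ) ^ r)) atTop (nhds 0) := by
  have hfactor : Tendsto (fun t : ℕ => C * (Real.log t / (t : ℝ) ^ r) - c) atTop (nhds (-c)) := by
    simpa only [mul_zero, zero_sub] using ((tendsto_log_div_rpow hr).const_mul C).sub_const c
  refine Real.tendsto_exp_atBot.comp
    (((tendsto_rpow_natCast hr).atTop_mul_neg (neg_lt_zero.mpr hc) hfactor).congr' ?_)
  filter_upwards [(tendsto_rpow_natCast hr).eventually_gt_atTop 0] with t ht
  field_simp

section Phase

variable {p₀ A B : ℝ}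

lemma tendsto_boxW (hp₀ : p₀ ≤ 1) (hA : 0 ≤ A) :
    Tendsto (fun t : ℕ => (boxW p₀ A t : ℝ) / √(t : ℝ)) atTop (nhds (A / (1 - p₀))) := by
  have hnonneg : 0 ≤ 1 / (1 - p₀) * A := by have := sub_nonneg.mpr hp₀; positivity
  rw [← one_div_mul_eq_div]
  exact (tendsto_nat_ceil_mul_div_atTop (R := ℝ) hnonneg).comp tendsto_sqrt_natCast

lemma tendsto_boxH (hp₀ : p₀ ≤ 1) (hB : 0 ≤ B) :
    Tendsto (fun t : ℕ => (boxH p₀ B t : ℝ) / √(t : ℝ)) atTop (nhds (B / (1 - p₀))) :=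
  tendsto_boxW hp₀ hB

lemma tendsto_gap (hp₀ : p₀ ≤ 1) :
    Tendsto (fun t : ℕ => (gap p₀ t : ℝ) / (√(t : ℝ) / Real.log t)) atTop
      (nhds (1 / (1 - p₀))) :=
  (tendsto_nat_ceil_mul_div_atTop (R := ℝ) (one_div_nonneg.mpr (sub_nonneg.mpr hp₀))).comp
    tendsto_sqrt_div_log

lemma tendsto_ceil_cbrt_div :
    Tendsto (fun t : ℕ => (⌈(t : ℝ) ^ ((1 : ℝ) / 3)⌉₊ : ℝ) / (√(t : ℝ) / Real.log t)) atTop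
      (nhds 0) := by
  have hceil : Tendsto (fun t : ℕ => (⌈(t : ℝ) ^ ((1 : ℝ) / 3)⌉₊ : ℝ) / (t : ℝ) ^ ((1 : ℝ) / 3))
      atTop (nhds 1) :=
    (tendsto_nat_ceil_div_atTop (R := ℝ)).comp (tendsto_rpow_natCast (by norm_num))
  have hprod := hceil.mul (tendsto_log_div_rpow (r := 1 / 6) (by norm_num))
  rw [mul_zero] at hprod
  refine hprod.congr' ?_
  filter_upwards [eventually_sqrt_log_pos] with t ⟨_, _, ht⟩
  have hsqrt : √(t : ℝ) = (t : ℝ) ^ ((1 : ℝ) / 3) * (t : ℝ) ^ ((1 : ℝ) / 6) := by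
    rw [Real.sqrt_eq_rpow, ← Real.rpow_add ht]; norm_num
  rw [hsqrt, div_div_eq_mul_div, div_mul_div_comm]

lemma tendsto_maxShift (hp₀ : p₀ ≤ 1) :
    Tendsto (fun t : ℕ => (maxShift p₀ t : ℝ) / (√(t : ℝ) / Real.log t)) atTop
      (nhds (1 / (1 - p₀))) := by
  simpa only [maxShift, Nat.cast_add, add_div, add_zero] using
    (tendsto_gap hp₀).add tendsto_ceil_cbrt_div

lemma tendsto_numLines (hp₀ : p₀ < 1) (hB : 0 ≤ B) :
    Tendsto (fun t : ℕ => (numLines p₀ B t : ℝ) / Real.log t) atTop (nhds (2 * B)) := by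
  have hq : 0 < 1 - p₀ := sub_pos.mpr hp₀
  have hlow : Tendsto (fun t : ℕ => 2 * (boxH p₀ B t : ℝ) / (gap p₀ t : ℝ) / Real.log t) atTop
      (nhds (2 * B)) := by
    have hratio := ((tendsto_boxH hp₀.le hB).const_mul 2).div (tendsto_gap hp₀.le) (by positivity)
    rw [show 2 * (B / (1 - p₀)) / (1 / (1 - p₀)) = 2 * B by field_simp] at hratio
    refine hratio.congr' ?_
    filter_upwards [eventually_sqrt_log_pos] with t ⟨_, hlog, _⟩
    simp only [Pi.div_apply]
    field_simp
  have hup : Tendsto (fun t : ℕ => 2 * (boxH p₀ B t : ℝ) / (gap p₀ t : ℝ) / Real.log t +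
      1 / Real.log t) atTop (nhds (2 * B)) := by
    simpa only [add_zero] using hlow.add tendsto_one_div_log
  refine tendsto_of_tendsto_of_tendsto_of_le_of_le' hlow hup ?_ ?_ <;>
    filter_upwards [eventually_sqrt_log_pos] with t ⟨_, hlog, _⟩
  · gcongr
    exact Nat.le_ceil _
  · rw [← add_div]
    gcongr
    exact (Nat.ceil_lt_add_one (by positivity)).le

lemma tendsto_vertical (hp₀ : p₀ < 1) (hB : 0 ≤ B) :
    Tendsto (fun t : ℕ => (2 * (boxH p₀ B t + maxShift p₀ t + numLines p₀ B t * gap p₀ t) : ℝ) /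
      (√(t : ℝ) * Real.log t)) atTop (nhds 0) := by
  have hinv := tendsto_one_div_log
  have hsum := ((((tendsto_boxH hp₀.le hB).mul hinv).add
    ((tendsto_maxShift hp₀.le).mul (hinv.mul hinv))).add
    (((tendsto_numLines hp₀ hB).mul (tendsto_gap hp₀.le)).mul hinv)).const_mul 2
  simp only [mul_zero, add_zero] at hsum
  refine hsum.congr' ?_
  filter_upwards [eventually_sqrt_log_pos] with t ⟨_, hlog, _⟩
  field_simp

lemma tendsto_phaseLength (hp₀ : p₀ < 1) (hA : 0 ≤ A) (hB : 0 ≤ B) :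
    Tendsto (fun t : ℕ => (phaseLength p₀ A B t : ℝ) / (√(t : ℝ) * Real.log t)) atTop
      (nhds (4 * A * B / (1 - p₀))) := by
  have hlow : Tendsto (fun t : ℕ => (2 * boxW p₀ A t * numLines p₀ B t : ℝ) /
      (√(t : ℝ) * Real.log t)) atTop (nhds (4 * A * B / (1 - p₀))) := by
    have hprod := ((tendsto_boxW hp₀.le hA).const_mul 2).mul (tendsto_numLines hp₀ hB)
    rw [show 2 * (A / (1 - p₀)) * (2 * B) = 4 * A * B / (1 - p₀) by ring] at hprod
    refine hprod.congr fun t => ?_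
    ring
  have hup := (hlow.add (((tendsto_boxW hp₀.le hA).mul tendsto_one_div_log).const_mul 2)).add
    (tendsto_vertical hp₀ hB)
  simp only [mul_zero, add_zero] at hup
  refine tendsto_of_tendsto_of_tendsto_of_le_of_le' hlow hup ?_ ?_ <;>
    filter_upwards [eventually_sqrt_log_pos] with t ⟨_, hlog, _⟩
  · gcongr
    exact_mod_cast le_phaseLength p₀ A B t
  · rw [div_mul_div_comm, mul_one, mul_div_assoc', ← add_div, ← add_div, add_assoc]
    gcongr
    exact_mod_cast phaseLength_le p₀ A B t

lemma tendsto_phaseLength_mul_maxShift_div (hp₀ : p₀ < 1) (hA : 0 ≤ A) (hB : 0 ≤ B) :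
    Tendsto (fun t : ℕ => (phaseLength p₀ A B t : ℝ) * maxShift p₀ t / t) atTop
      (nhds (4 * A * B / (1 - p₀) ^ 2)) := by
  have hprod := (tendsto_phaseLength hp₀ hA hB).mul (tendsto_maxShift hp₀.le)
  rw [div_mul_div_comm, mul_one, ← sq] at hprod
  refine hprod.congr' ?_
  filter_upwards [eventually_sqrt_log_pos] with t ⟨_, hlog, ht⟩
  conv_rhs => rw [← Real.mul_self_sqrt ht.le]
  field_simp

lemma tendsto_phaseLength_div (hp₀ : p₀ < 1) (hA : 0 ≤ A) (hB : 0 ≤ B) :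
    Tendsto (fun t : ℕ => (phaseLength p₀ A B t : ℝ) / t) atTop (nhds 0) := by
  have hprod := (tendsto_phaseLength hp₀ hA hB).mul tendsto_log_div_sqrt
  rw [mul_zero] at hprod
  refine hprod.congr' ?_
  filter_upwards [eventually_sqrt_log_pos] with t ⟨_, hlog, ht⟩
  conv_rhs => rw [← Real.mul_self_sqrt ht.le]
  field_simp

lemma eventually_vertical_le (hp₀ : p₀ < 1) (hA : 0 < A) (hB : 0 < B) {ε : ℝ} (hε : 0 < ε) :
    ∀ᶠ t : ℕ in atTop, (2 * (boxH p₀ B t + maxShift p₀ t + numLines p₀ B t * gap p₀ t) : ℝ) ≤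
      ε * phaseLength p₀ A B t := by
  have := sub_pos.mpr hp₀
  have hlt : 0 < ε * (4 * A * B / (1 - p₀)) := by positivity
  filter_upwards [(tendsto_vertical hp₀ hB.le).eventually_lt
    ((tendsto_phaseLength hp₀ hA.le hB.le).const_mul ε) hlt, eventually_sqrt_log_pos]
    with t hratio ⟨hsqrt, hlog, _⟩
  rw [mul_div_assoc'] at hratio
  exact ((div_lt_div_iff_of_pos_right (by positivity)).mp hratio).le

end Phase

/-- Half of the extent in the direction `e`, in units of `√t`, of the box that the agent sweeps on
average in a phase that starts at time `t`. -/
noncomputable def sweptExtent (p p₀ A B : ℝ) (e : Dir) : ℝ :=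
  (1 - p) / (1 - p₀) * if e.Vertical then B else A

section Phase

variable {p₀ A B : ℝ}

lemma two_mul_boxH_le {t : ℕ} (hgap : 0 < gap p₀ t) :
    2 * boxH p₀ B t ≤ numLines p₀ B t * gap p₀ t := by
  have hceil : 2 * (boxH p₀ B t : ℝ) / gap p₀ t ≤ numLines p₀ B t := Nat.le_ceil _
  rw [div_le_iff₀ (Nat.cast_pos.mpr hgap)] at hceil
  exact_mod_cast hceil

lemma eventually_add_mul_rpow_lt_mul_sqrt (a b : ℝ) {c : ℝ} (hc : 0 < c) :
    ∀ᶠ t : ℕ in atTop, a + b * (t : ℝ) ^ ((1 : ℝ) / 3) < c * √(t : ℝ) := by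
  have hrpow : Tendsto (fun t : ℕ => (t : ℝ) ^ (-((1 : ℝ) / 6))) atTop (nhds 0) :=
    (tendsto_rpow_neg_atTop (by norm_num)).comp tendsto_natCast_atTop_atTop
  have hlim := (tendsto_sqrt_natCast.const_div_atTop a).add (hrpow.const_mul b)
  rw [mul_zero, add_zero] at hlim
  filter_upwards [hlim.eventually_lt_const hc, eventually_sqrt_log_pos] with t hlt ⟨hsqrt, _, ht⟩
  have hmul : (t : ℝ) ^ (-((1 : ℝ) / 6)) * √(t : ℝ) = (t : ℝ) ^ ((1 : ℝ) / 3) := by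
    rw [Real.sqrt_eq_rpow, ← Real.rpow_add ht]; norm_num
  calc a + b * (t : ℝ) ^ ((1 : ℝ) / 3)
      = (a / √(t : ℝ) + b * (t : ℝ) ^ (-((1 : ℝ) / 6))) * √(t : ℝ) := by
        rw [add_mul, div_mul_cancel₀ _ hsqrt.ne', mul_assoc, hmul]
    _ < c * √(t : ℝ) := mul_lt_mul_of_pos_right hlt hsqrt

/-- With `s = t ^ (-1/4)` the term `s * δ` is of order `t ^ (1/12)`, whereas `s ^ 2` times the
length of the phase is only of order `log t`. -/
lemma eventually_phaseLength_mul_exp_le (hp₀ : p₀ < 1) (hA : 0 ≤ A) (hB : 0 ≤ B) {c η : ℝ}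
    (hc : 0 < c) (hη : 0 < η) :
    ∀ᶠ t : ℕ in atTop, 4 * ((phaseLength p₀ A B t : ℝ) + 1) *
      Real.exp (-(t : ℝ) ^ (-((1 : ℝ) / 4)) * (c * (t : ℝ) ^ ((1 : ℝ) / 3)) +
        5 * ((t : ℝ) ^ (-((1 : ℝ) / 4))) ^ 2 * phaseLength p₀ A B t) ≤ η := by
  set C := 4 * A * B / (1 - p₀) + 1
  filter_upwards [eventually_sqrt_log_pos, eventually_ge_atTop 2,
    (tendsto_phaseLength hp₀ hA hB).eventually_le_const (lt_add_one _),
    (tendsto_phaseLength_div hp₀ hA hB).eventually_le_const (show (0 : ℝ) < 1 / 2 by norm_num),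
    (tendsto_exp_log_sub_rpow (5 * C + 1) (r := 1 / 12) hc (by norm_num)).eventually_le_const
      (show 0 < η / 4 by positivity)]
    with t ⟨hsqrt, hlog, ht⟩ ht2 hlen hlen' hsmall
  have hlen_le : (phaseLength p₀ A B t : ℝ) + 1 ≤ t := by
    rw [div_le_iff₀ ht] at hlen'
    have : (2 : ℝ) ≤ t := by exact_mod_cast ht2
    linarith
  have hlinear : (t : ℝ) ^ (-((1 : ℝ) / 4)) * (c * (t : ℝ) ^ ((1 : ℝ) / 3)) =
      c * (t : ℝ) ^ ((1 : ℝ) / 12) := by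
    rw [mul_left_comm, ← Real.rpow_add ht]; norm_num
  have hquadratic : ((t : ℝ) ^ (-((1 : ℝ) / 4))) ^ 2 * phaseLength p₀ A B t ≤ C * Real.log t := by
    have hsq : ((t : ℝ) ^ (-((1 : ℝ) / 4))) ^ 2 = (√(t : ℝ))⁻¹ := by
      rw [← Real.rpow_natCast, ← Real.rpow_mul ht.le, Real.sqrt_eq_rpow, ← Real.rpow_neg ht.le]
      norm_num
    rw [div_le_iff₀ (by positivity)] at hlen
    rw [hsq, inv_mul_le_iff₀ hsqrt]
    linarith
  calc 4 * ((phaseLength p₀ A B t : ℝ) + 1) *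
        Real.exp (-(t : ℝ) ^ (-((1 : ℝ) / 4)) * (c * (t : ℝ) ^ ((1 : ℝ) / 3)) +
          5 * ((t : ℝ) ^ (-((1 : ℝ) / 4))) ^ 2 * phaseLength p₀ A B t)
      ≤ 4 * t * Real.exp (-(c * (t : ℝ) ^ ((1 : ℝ) / 12)) + 5 * (C * Real.log t)) := by
        refine mul_le_mul (by linarith) (Real.exp_le_exp.mpr ?_) (Real.exp_pos _).le (by positivity)
        linarith
    _ = 4 * Real.exp ((5 * C + 1) * Real.log t - c * (t : ℝ) ^ ((1 : ℝ) / 12)) := by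
        rw [mul_assoc 4]
        nth_rewrite 1 [← Real.exp_log ht]
        rw [← Real.exp_add]
        ring_nf
    _ ≤ η := by linarith

lemma mul_sqrt_le_mul_boxW (D : ℝ) {p : ℝ} (hp1 : p ≤ 1) (t : ℕ) :
    (1 - p) / (1 - p₀) * D * √(t : ℝ) ≤ (1 - p) * boxW p₀ D t := by
  calc _ = (1 - p) * (1 / (1 - p₀) * D * √(t : ℝ)) := by ring
    _ ≤ _ := mul_le_mul_of_nonneg_left (Nat.le_ceil _) (sub_nonneg.mpr hp1)

lemma rpow_le_maxShift_sub_gap (t : ℕ) :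
    (t : ℝ) ^ ((1 : ℝ) / 3) ≤ (maxShift p₀ t : ℝ) - gap p₀ t := by
  rw [maxShift, Nat.cast_add, add_sub_cancel_left]
  exact Nat.le_ceil _

/-- The bounds on `x` say that the home is well inside the box swept by the agent from `x`. -/
lemma eventually_one_sub_le_sum_wordProb_hits {p ε η : ℝ} (hp₀ : p₀ < 1) (hA : 0 < A) (hB : 0 < B)
    (hp : 0 ≤ p) (hp1 : p < 1) (hε : 0 < ε) (hη : 0 < η) (home : ℤ × ℤ) :
    ∀ᶠ t : ℕ in atTop, ∀ x : ℤ × ℤ,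
      (∀ e : Dir, (e.comp x : ℝ) ≤ (1 - ε) * sweptExtent p p₀ A B e * √(t : ℝ)) →
      1 - η ≤ ∑ z ∈ Finset.Icc 1 (maxShift p₀ t),
        wordProb p (phaseLength p₀ A B t) {w | Hits x home (phase p₀ A B t z) w} := by
  have : 0 < 1 - p₀ := sub_pos.mpr hp₀
  have hq : 0 < 1 - p := sub_pos.mpr hp1
  have hmargin (D : ℝ) (hD : 0 < D) := eventually_add_mul_rpow_lt_mul_sqrt
    (|(home.1 : ℝ)| + |(home.2 : ℝ)|) (4 * ((1 - p) / 9))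
    (show 0 < ε * ((1 - p) / (1 - p₀) * D) by positivity)
  filter_upwards [eventually_sqrt_log_pos, hmargin A hA, hmargin B hB,
    eventually_phaseLength_mul_exp_le hp₀ hA.le hB.le (show 0 < (1 - p) / 9 by positivity) hη,
    ((tendsto_rpow_neg_atTop (by norm_num : (0 : ℝ) < 1 / 4)).comp
      tendsto_natCast_atTop_atTop).eventually_le_const (show (0 : ℝ) < 1 / 2 by norm_num)]
    with t ⟨_, hlog, ht⟩ hmarginA hmarginB hexp hs x hx
  have hboxA := mul_sqrt_le_mul_boxW (p₀ := p₀) A hp1.le t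
  have hboxB : _ ≤ (1 - p) * (boxH p₀ B t : ℝ) := mul_sqrt_le_mul_boxW B hp1.le t
  have hgap : 0 < gap p₀ t := Nat.ceil_pos.mpr (by positivity)
  have hcbrt : 0 < (t : ℝ) ^ ((1 : ℝ) / 3) := by positivity
  have hshift : 8 * ((1 - p) / 9 * (t : ℝ) ^ ((1 : ℝ) / 3)) <
      (1 - p) * ((maxShift p₀ t : ℝ) - gap p₀ t) := by
    nlinarith [mul_le_mul_of_nonneg_left (rpow_le_maxShift_sub_gap (p₀ := p₀) t) hq.le]
  have hmargin_pos : 0 < (1 - p) / 9 * (t : ℝ) ^ ((1 : ℝ) / 3) := by positivity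
  have hhome₁ := abs_le.mp (le_refl |(home.1 : ℝ)|)
  have hhome₂ := abs_le.mp (le_refl |(home.2 : ℝ)|)
  have := abs_nonneg (home.1 : ℝ)
  have := abs_nonneg (home.2 : ℝ)
  have hxE := hx .east
  have hxW := hx .west
  have hxN := hx .north
  have hxS := hx .south
  simp only [Dir.comp, Dir.vec, sweptExtent, Dir.Vertical, reduceCtorEq, or_self, or_true, true_or,
    if_true, if_false, one_mul, zero_mul, neg_mul, add_zero, zero_add, Int.cast_neg]
    at hxE hxW hxN hxS
  have hsum := one_sub_le_sum_wordProb_hits (s := (t : ℝ) ^ (-((1 : ℝ) / 4)))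
    (δ := (1 - p) / 9 * (t : ℝ) ^ ((1 : ℝ) / 3)) hp hp1 (by positivity) hs
    (x := x) (home := home) (w := boxW p₀ A t) (h := boxH p₀ B t) (n := numLines p₀ B t)
    (L := phaseLength p₀ A B t) (M := maxShift p₀ t)
    (fun z => List.replicate (maxShift p₀ t - z) Dir.north ++
      straight (-displacement (sweep p₀ A B t z))) hgap
    (fun z hz => by rw [← phase_eq_approach_append, length_phase p₀ A B t z hz])
    (by rw [Prod.fst_sub, Int.cast_sub]; linarith)
    (by rw [Prod.fst_sub, Int.cast_sub]; linarith)
    (by rw [Prod.snd_sub, Int.cast_sub]; linarith)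
    (by rw [Prod.snd_sub, Int.cast_sub]; linarith) (two_mul_boxH_le hgap) hshift
  simp only [← phase_eq_approach_append] at hsum
  linarith

end Phase

/-! ### A pair of coupled recursions -/

section Recursion

variable {α b ε γ K r : ℝ}

lemma exp_neg_mul_sub_one_le_rpow_neg (hα : 0 ≤ α) (hr : 0 < r) :
    Real.exp (-(α * (r - 1))) ≤ r ^ (-α) := by
  rw [Real.rpow_def_of_pos hr, Real.exp_le_exp]
  linarith [mul_le_mul_of_nonneg_left (Real.log_le_sub_one_of_pos hr) hα]

lemma exp_rpow_mul_exp_le_exp_mul_rpow (hα : 0 ≤ α) (hb : 0 ≤ b) (hr : 0 < r) (hr1 : r ≤ 1)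
    (hrε : 2 * α ≤ (2 * α + ε) * r) :
    Real.exp (2 * b + 2 * α + ε) ^ r * Real.exp (b * (1 - r ^ 2)) ≤
      Real.exp (2 * b + 2 * α + ε) * r ^ (2 * α) := by
  rw [← Real.exp_mul, Real.rpow_def_of_pos hr, ← Real.exp_add, ← Real.exp_add, Real.exp_le_exp]
  have hlog : 2 * α * (1 - r⁻¹) ≤ 2 * α * Real.log r :=
    mul_le_mul_of_nonneg_left (Real.one_sub_inv_le_log_of_pos hr) (by positivity)
  have hinv : 2 * α * r⁻¹ ≤ 2 * α + ε := by rwa [← div_eq_mul_inv, div_le_iff₀ hr]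
  have hone_sub : 2 * α * (1 - r⁻¹) = -((1 - r) * (2 * α * r⁻¹)) := by field_simp; ring
  have hmul := mul_le_mul_of_nonneg_left hinv (sub_nonneg.mpr hr1)
  nlinarith [mul_nonneg hb (sq_nonneg (1 - r))]

lemma sqrt_div_rpow_two_mul {s s' : ℝ} (hs : 0 ≤ s) (hs' : 0 ≤ s') (α : ℝ) :
    √(s / s') ^ (2 * α) = (s' / s) ^ (-α) := by
  rw [Real.rpow_mul (Real.sqrt_nonneg _), Real.rpow_two, Real.sq_sqrt (div_nonneg hs hs'),
    Real.rpow_neg (div_nonneg hs' hs), ← Real.inv_rpow (div_nonneg hs' hs), inv_div]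

lemma one_sub_mul_add_mul_le_mul_exp_neg {x y h f S : ℝ} (hγ : 0 ≤ γ) (hy : 0 ≤ y) (hh0 : 0 ≤ h)
    (hh1 : h ≤ 1) (hf : f ≤ y) (hS : S ≤ 4 * (K * y)) (hx : x ≤ h * (1 - 4 * γ * K)) :
    (1 - h) * f + h * (γ * S) ≤ y * Real.exp (-x) := by
  have := sub_nonneg.mpr hh1
  calc (1 - h) * f + h * (γ * S) ≤ (1 - h) * y + h * (γ * (4 * (K * y))) := by gcongr
    _ = y * (-(h * (1 - 4 * γ * K)) + 1) := by ring
    _ ≤ y * Real.exp (-(h * (1 - 4 * γ * K))) := by gcongr; exact Real.add_one_le_exp _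
    _ ≤ y * Real.exp (-x) := by gcongr

lemma convexCombination_mul_exp_le {y f F : ℝ} (hα : 0 ≤ α) (hb : 0 ≤ b)
    (hK : K = Real.exp (2 * b + 2 * α + ε)) (hr : 0 < r) (hr1 : r ≤ 1)
    (hrε : 2 * α ≤ (2 * α + ε) * r) (hy : 0 ≤ y) (hf : f ≤ y) (hF : F ≤ K * y) :
    (r * K ^ (r - 1) * F + (1 - r) * K ^ r * f) * Real.exp (b * (1 - r ^ 2)) ≤
      K * (y * r ^ (2 * α)) := by
  have hKpos : 0 < K := hK ▸ Real.exp_pos _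
  have := sub_nonneg.mpr hr1
  calc (r * K ^ (r - 1) * F + (1 - r) * K ^ r * f) * Real.exp (b * (1 - r ^ 2))
      ≤ (r * K ^ (r - 1) * (K * y) + (1 - r) * K ^ r * y) * Real.exp (b * (1 - r ^ 2)) := by
        gcongr
    _ = K ^ r * Real.exp (b * (1 - r ^ 2)) * y := by
        rw [Real.rpow_sub_one hKpos.ne']; field_simp; ring
    _ ≤ K * r ^ (2 * α) * y := by
        rw [hK]; gcongr ?_ * y
        exact exp_rpow_mul_exp_le_exp_mul_rpow hα hb hr hr1 hrε
    _ = K * (y * r ^ (2 * α)) := by ring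

/-- In the application `τ i` is the starting time of phase `i`, `f i` is the probability that the
home has not been found at time `τ i`, and `F e i` is an exponential moment of the position in
direction `e` on that event. Both bounds propagate together: `F` is controlled by `f` because a
phase contracts the moment, and `f` decreases unless some `F e` is large. -/
lemma exists_forall_le_mul_rpow_neg {τ f h ρ : ℕ → ℝ} {F : Dir → ℕ → ℝ} {i₀ : ℕ}
    (hα : 0 ≤ α) (hb : 0 ≤ b) (hγ : 0 ≤ γ) (hK : K = Real.exp (2 * b + 2 * α + ε))
    (hτ : ∀ i ≥ i₀, 0 < τ i) (hρ : ∀ i ≥ i₀, ρ i = √(τ i / τ (i + 1)))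
    (hρ1 : ∀ i ≥ i₀, ρ i ≤ 1) (hρε : ∀ i ≥ i₀, 2 * α ≤ (2 * α + ε) * ρ i)
    (hh0 : ∀ i ≥ i₀, 0 ≤ h i) (hh1 : ∀ i ≥ i₀, h i ≤ 1)
    (hF : ∀ i ≥ i₀, ∀ e, F e (i + 1) ≤
      (ρ i * K ^ (ρ i - 1) * F e i + (1 - ρ i) * K ^ ρ i * f i) * Real.exp (b * (1 - ρ i ^ 2)))
    (hf : ∀ i ≥ i₀, f (i + 1) ≤ (1 - h i) * f i + h i * (γ * ∑ e, F e i))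
    (hτh : ∀ i ≥ i₀, α * ((τ (i + 1) - τ i) / τ i) ≤ h i * (1 - 4 * γ * K)) :
    ∃ C, ∀ i ≥ i₀, f i ≤ C * τ i ^ (-α) := by
  have hKpos : 0 < K := hK ▸ Real.exp_pos _
  obtain ⟨C, hC, hf0, hF0⟩ : ∃ C, 0 ≤ C ∧ f i₀ ≤ C * τ i₀ ^ (-α) ∧
      ∀ e, F e i₀ ≤ K * (C * τ i₀ ^ (-α)) := by
    have hlim : Tendsto (fun C : ℝ => C * τ i₀ ^ (-α)) atTop atTop :=
      tendsto_id.atTop_mul_const (Real.rpow_pos_of_pos (hτ i₀ le_rfl) _)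
    exact ((eventually_ge_atTop 0).and ((hlim.eventually_ge_atTop _).and <| eventually_all.mpr
      fun e => (hlim.const_mul_atTop hKpos).eventually_ge_atTop (F e i₀))).exists
  refine ⟨C, fun i hi => ?_⟩
  suffices f i ≤ C * τ i ^ (-α) ∧ ∀ e, F e i ≤ K * (C * τ i ^ (-α)) from this.1
  induction i, hi using Nat.le_induction with
  | base => exact ⟨hf0, hF0⟩
  | succ i hi ih =>
    obtain ⟨ihf, ihF⟩ := ih
    have hτi := hτ i hi
    have hτi' := hτ (i + 1) (by omega)
    have hratio : 0 < τ (i + 1) / τ i := div_pos hτi' hτi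
    have hρ0 : 0 < ρ i := hρ i hi ▸ Real.sqrt_pos.mpr (div_pos hτi hτi')
    have hρpow : ρ i ^ (2 * α) = (τ (i + 1) / τ i) ^ (-α) := by
      rw [hρ i hi, sqrt_div_rpow_two_mul hτi.le hτi'.le]
    have hy : 0 ≤ C * τ i ^ (-α) := by positivity
    have hy' : C * τ (i + 1) ^ (-α) = C * τ i ^ (-α) * ρ i ^ (2 * α) := by
      rw [hρpow, mul_assoc, ← Real.mul_rpow hτi.le hratio.le, mul_div_cancel₀ _ hτi.ne']
    rw [hy']
    refine ⟨?_, fun e => (hF i hi e).trans <|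
      convexCombination_mul_exp_le hα hb hK hρ0 (hρ1 i hi) (hρε i hi) hy ihf (ihF e)⟩
    have hsum : ∑ e, F e i ≤ 4 * (K * (C * τ i ^ (-α))) := by
      have hcard : ∑ e, F e i ≤ 4 • (K * (C * τ i ^ (-α))) :=
        Finset.sum_le_card_nsmul Finset.univ (F · i) _ fun e _ => ihF e
      simpa only [nsmul_eq_mul, Nat.cast_ofNat] using hcard
    refine (hf i hi).trans <| (one_sub_mul_add_mul_le_mul_exp_neg hγ hy (hh0 i hi) (hh1 i hi) ihf
      hsum (hτh i hi)).trans ?_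
    rw [hρpow, ← div_sub_one hτi.ne']
    gcongr
    exact exp_neg_mul_sub_one_le_rpow_neg hα hratio

end Recursion

/-! ### Independence of the past -/

lemma iIndep_sumElim {Ω ι κ : Type*} {mΩ : MeasurableSpace Ω} {μ : Measure Ω}
    {m₁ : ι → MeasurableSpace Ω} {m₂ : κ → MeasurableSpace Ω} (h₁ : iIndep m₁ μ)
    (h₂ : iIndep m₂ μ) (h : Indep (⨆ i, m₁ i) (⨆ j, m₂ j) μ) : iIndep (Sum.elim m₁ m₂) μ := by
  rw [iIndep_iff]
  intro s f hf
  have hf₁ : ∀ i ∈ s.toLeft, MeasurableSet[m₁ i] (f (.inl i)) := fun i hi =>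
    hf _ (Finset.mem_toLeft.mp hi)
  have hf₂ : ∀ j ∈ s.toRight, MeasurableSet[m₂ j] (f (.inr j)) := fun j hj =>
    hf _ (Finset.mem_toRight.mp hj)
  have hsplit : (⋂ k ∈ s, f k) =
      (⋂ i ∈ s.toLeft, f (.inl i)) ∩ (⋂ j ∈ s.toRight, f (.inr j)) := by
    ext ω
    simp only [Set.mem_iInter, Set.mem_inter_iff, Finset.mem_toLeft, Finset.mem_toRight,
      Sum.forall]
  have hmeas₁ : MeasurableSet[⨆ i, m₁ i] (⋂ i ∈ s.toLeft, f (.inl i)) :=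
    Finset.measurableSet_biInter _ fun i hi => le_iSup m₁ i _ (hf₁ i hi)
  have hmeas₂ : MeasurableSet[⨆ j, m₂ j] (⋂ j ∈ s.toRight, f (.inr j)) :=
    Finset.measurableSet_biInter _ fun j hj => le_iSup m₂ j _ (hf₂ j hj)
  rw [hsplit, (Indep_iff _ _ μ).mp h _ _ hmeas₁ hmeas₂, h₁.meas_biInter hf₁, h₂.meas_biInter hf₂]
  conv_rhs => rw [← Finset.toLeft_disjSum_toRight (u := s), Finset.prod_disjSum]

instance : DiscreteMeasurableSpace Outcome := ⟨fun _ => trivial⟩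

section Word

/-- The outcomes of `n` steps from time `t` on. -/
def outcomeWord (x : ℕ → Outcome) (t n : ℕ) : List Outcome := (List.range' t n).map x

lemma outcomeWord_succ (x : ℕ → Outcome) (t n : ℕ) :
    outcomeWord x t (n + 1) = x t :: outcomeWord x (t + 1) n := rfl

lemma length_outcomeWord (x : ℕ → Outcome) (t n : ℕ) : (outcomeWord x t n).length = n := by
  rw [outcomeWord, List.length_map, List.length_range']

lemma outcomeWord_congr {x x' : ℕ → Outcome} {t n : ℕ} (h : ∀ s < t + n, x s = x' s) :
    outcomeWord x t n = outcomeWord x' t n :=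
  List.map_congr_left fun s hs => h s (List.mem_range'_1.mp hs).2

lemma outcomeWord_add (x : ℕ → Outcome) (t m n : ℕ) :
    outcomeWord x t (m + n) = outcomeWord x t m ++ outcomeWord x (t + m) n := by
  simp only [outcomeWord, ← List.map_append, List.range'_append_1]

lemma take_outcomeWord (x : ℕ → Outcome) (t : ℕ) {k n : ℕ} (hk : k ≤ n) :
    (outcomeWord x t n).take k = outcomeWord x t k := by
  obtain ⟨m, rfl⟩ := Nat.exists_eq_add_of_le hk
  rw [outcomeWord_add, List.take_left' (length_outcomeWord ..)]

end Word

section Past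

variable {Ω : Type*}

/-- The σ-algebras generated by the single outcomes (indexed on the left) and by the single
shifts (indexed on the right). -/
abbrev sourceSigma (ξ : ℕ → Ω → Outcome) (Z : ℕ → Ω → ℕ) : ℕ ⊕ ℕ → MeasurableSpace Ω :=
  Sum.elim (fun s => MeasurableSpace.comap (ξ s) inferInstance)
    (fun j => MeasurableSpace.comap (Z j) inferInstance)

/-- The σ-algebra generated by the first `t` outcomes and the first `i` shifts. -/
abbrev pastSigma (ξ : ℕ → Ω → Outcome) (Z : ℕ → Ω → ℕ) (t i : ℕ) : MeasurableSpace Ω :=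
  ⨆ k ∈ {k : ℕ ⊕ ℕ | Sum.elim (· < t) (· < i) k}, sourceSigma ξ Z k

variable {ξ : ℕ → Ω → Outcome} {Z : ℕ → Ω → ℕ}

lemma pastSigma_mono {t t' i : ℕ} (h : t ≤ t') : pastSigma ξ Z t i ≤ pastSigma ξ Z t' i := by
  refine biSup_mono fun k hk => ?_
  rcases k with s | j
  · exact lt_of_lt_of_le hk h
  · exact hk

lemma measurableSet_pastSigma {t i : ℕ} {Q : (ℕ → Outcome) → (ℕ → ℕ) → Prop}
    (hQ : ∀ x x' z z', (∀ s < t, x s = x' s) → (∀ j < i, z j = z' j) → Q x z → Q x' z') :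
    MeasurableSet[pastSigma ξ Z t i] {ω | Q (fun s => ξ s ω) (fun j => Z j ω)} := by
  have hsource (k : ℕ ⊕ ℕ) (hk : Sum.elim (· < t) (· < i) k) :
      sourceSigma ξ Z k ≤ pastSigma ξ Z t i :=
    le_iSup₂_of_le (f := fun k (_ : k ∈ {k : ℕ ⊕ ℕ | Sum.elim (· < t) (· < i) k}) =>
      sourceSigma ξ Z k) k hk le_rfl
  have hmeas : @Measurable _ _ (pastSigma ξ Z t i) _
      (fun ω => ((fun s : Fin t => ξ s ω), (fun j : Fin i => Z j ω))) :=
    Measurable.prodMk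
      (@measurable_pi_lambda _ _ _ (pastSigma ξ Z t i) _ _ fun s =>
        measurable_iff_comap_le.mpr (hsource (.inl s) s.2))
      (@measurable_pi_lambda _ _ _ (pastSigma ξ Z t i) _ _ fun j =>
        measurable_iff_comap_le.mpr (hsource (.inr j) j.2))
  have hpreimage : {ω | Q (fun s => ξ s ω) (fun j => Z j ω)} =
      (fun ω => ((fun s : Fin t => ξ s ω), (fun j : Fin i => Z j ω))) ⁻¹'
        {xz | Q (fun s => if hs : s < t then xz.1 ⟨s, hs⟩ else .follow)
          (fun j => if hj : j < i then xz.2 ⟨j, hj⟩ else 0)} := by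
    ext ω
    constructor <;> refine hQ _ _ _ _ ?_ ?_ <;> intro s hs <;> simp [hs]
  rw [hpreimage]
  exact hmeas MeasurableSet.of_discrete

variable [mΩ : MeasurableSpace Ω] {μ : Measure Ω} {p p₀ A B : ℝ} {t₀ : ℕ}

namespace IsSweepingRandomness

lemma sourceSigma_le (h : IsSweepingRandomness μ p p₀ A B t₀ ξ Z) (k : ℕ ⊕ ℕ) :
    sourceSigma ξ Z k ≤ mΩ := by
  rcases k with s | j
  · exact (h.measurable_outcome s).comap_le
  · exact (h.measurable_shift j).comap_le

lemma pastSigma_le (h : IsSweepingRandomness μ p p₀ A B t₀ ξ Z) (t i : ℕ) :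
    pastSigma ξ Z t i ≤ mΩ :=
  iSup₂_le fun k _ => h.sourceSigma_le k

lemma iIndep_sourceSigma (h : IsSweepingRandomness μ p p₀ A B t₀ ξ Z) :
    iIndep (sourceSigma ξ Z) μ := by
  refine iIndep_sumElim h.indep_outcome h.indep_shift ?_
  simpa only [IndepFun_iff_Indep, MeasurableSpace.comap_process_pi] using h.indep_outcome_shift

lemma measureReal_inter_source (h : IsSweepingRandomness μ p p₀ A B t₀ ξ Z)
    {t i : ℕ} {k : ℕ ⊕ ℕ} (hk : ¬ Sum.elim (· < t) (· < i) k) {E E' : Set Ω}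
    (hE : MeasurableSet[pastSigma ξ Z t i] E) (hE' : MeasurableSet[sourceSigma ξ Z k] E') :
    μ.real (E ∩ E') = μ.real E * μ.real E' := by
  have hindep := indep_iSup_of_disjoint h.sourceSigma_le h.iIndep_sourceSigma
    (Set.disjoint_singleton_right.mpr hk :
      Disjoint {k : ℕ ⊕ ℕ | Sum.elim (· < t) (· < i) k} {k})
  rw [iSup_singleton, Indep_iff] at hindep
  simp only [measureReal_def, hindep E E' hE hE', ENNReal.toReal_mul]

lemma measureReal_inter_outcome (h : IsSweepingRandomness μ p p₀ A B t₀ ξ Z) (hp : 0 ≤ p)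
    (hp1 : p ≤ 1) {t i : ℕ} {E : Set Ω} (hE : MeasurableSet[pastSigma ξ Z t i] E) (o : Outcome) :
    μ.real (E ∩ {ω | ξ t ω = o}) = μ.real E * outcomeProb p o := by
  rw [h.measureReal_inter_source (k := .inl t) (E' := {ω | ξ t ω = o}) (lt_irrefl t) hE
    ⟨{o}, trivial, rfl⟩]
  congr 1
  rcases o with _ | d
  · rw [measureReal_def, h.prob_follow, ENNReal.toReal_ofReal (by linarith), outcomeProb]
  · rw [measureReal_def, h.prob_mistake, ENNReal.toReal_ofReal (by linarith), outcomeProb]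

lemma measureReal_inter_shift (h : IsSweepingRandomness μ p p₀ A B t₀ ξ Z)
    {t i : ℕ} {E : Set Ω} (hE : MeasurableSet[pastSigma ξ Z t i] E) {z : ℕ}
    (hz : z ∈ Finset.Icc 1 (maxShift p₀ (startTime p₀ A B t₀ i))) :
    μ.real (E ∩ {ω | Z i ω = z}) = μ.real E / maxShift p₀ (startTime p₀ A B t₀ i) := by
  rw [h.measureReal_inter_source (k := .inr i) (E' := {ω | Z i ω = z}) (lt_irrefl i) hE
    ⟨{z}, MeasurableSet.of_discrete, rfl⟩, div_eq_mul_inv]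
  congr 1
  rw [measureReal_def, h.prob_shift i z hz, ENNReal.toReal_inv, ENNReal.toReal_natCast]

lemma ae_shift_mem [IsProbabilityMeasure μ] (h : IsSweepingRandomness μ p p₀ A B t₀ ξ Z)
    (hM : ∀ i, 0 < maxShift p₀ (startTime p₀ A B t₀ i)) :
    ∀ᵐ ω ∂μ, ∀ i, Z i ω ∈ Finset.Icc 1 (maxShift p₀ (startTime p₀ A B t₀ i)) := by
  refine ae_all_iff.mpr fun i => ?_
  set M := maxShift p₀ (startTime p₀ A B t₀ i)
  have hmeas : MeasurableSet (Z i ⁻¹' Finset.Icc 1 M) :=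
    h.measurable_shift i (Finset.measurableSet _)
  refine (prob_compl_eq_zero_iff hmeas).mpr ?_
  calc μ (Z i ⁻¹' Finset.Icc 1 M) = ∑ z ∈ Finset.Icc 1 M, μ (Z i ⁻¹' {z}) :=
        (sum_measure_preimage_singleton _ fun z _ =>
          h.measurable_shift i (measurableSet_singleton z)).symm
    _ = ∑ _ ∈ Finset.Icc 1 M, (M : ENNReal)⁻¹ := Finset.sum_congr rfl (h.prob_shift i)
    _ = 1 := by
      rw [Finset.sum_const, Nat.card_Icc, nsmul_eq_mul, Nat.add_sub_cancel]
      exact ENNReal.mul_inv_cancel (Nat.cast_ne_zero.mpr (hM i).ne') (ENNReal.natCast_ne_top _)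

lemma measureReal_inter_outcomeWord [IsProbabilityMeasure μ]
    (h : IsSweepingRandomness μ p p₀ A B t₀ ξ Z) (hp : 0 ≤ p) (hp1 : p ≤ 1) {t i : ℕ} {E : Set Ω}
    (hE : MeasurableSet[pastSigma ξ Z t i] E) (n : ℕ) (S : Set (List Outcome)) :
    μ.real (E ∩ {ω | outcomeWord (fun s => ξ s ω) t n ∈ S}) = μ.real E * wordProb p n S := by
  induction n generalizing t E S with
  | zero =>
    rw [show wordProb p 0 S = S.indicator 1 [] from rfl]
    by_cases hS : [] ∈ S <;> simp [outcomeWord, hS]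
  | succ n ih =>
    have hpart (o : Outcome) :
        MeasurableSet[pastSigma ξ Z (t + 1) i] (E ∩ {ω | ξ t ω = o}) :=
      (pastSigma_mono t.le_succ _ hE).inter <|
        measurableSet_pastSigma (Q := fun x _ => x t = o) fun x x' _ _ hx _ hxt =>
          (hx t t.lt_succ_self) ▸ hxt
    have hword (o : Outcome) :
        MeasurableSet {ω | o :: outcomeWord (fun s => ξ s ω) (t + 1) n ∈ S} :=
      h.pastSigma_le (t + 1 + n) i _ <|
        measurableSet_pastSigma (Q := fun x _ => o :: outcomeWord x (t + 1) n ∈ S)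
          fun x x' _ _ hx _ hS => outcomeWord_congr hx ▸ hS
    have hsplit : E ∩ {ω | outcomeWord (fun s => ξ s ω) t (n + 1) ∈ S} =
        ⋃ o ∈ (Finset.univ : Finset Outcome), (E ∩ {ω | ξ t ω = o}) ∩
          {ω | o :: outcomeWord (fun s => ξ s ω) (t + 1) n ∈ S} := by
      ext ω
      simp only [outcomeWord_succ, Set.mem_inter_iff, Set.mem_ofPred_eq, Finset.mem_univ,
        Set.iUnion_true, Set.mem_iUnion]
      exact ⟨fun ⟨hω, hS⟩ => ⟨_, ⟨hω, rfl⟩, hS⟩, fun ⟨_, ⟨hω, ho⟩, hS⟩ => ⟨hω, ho ▸ hS⟩⟩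
    have hdisjoint : Set.PairwiseDisjoint ((Finset.univ : Finset Outcome) : Set Outcome)
        fun o => (E ∩ {ω | ξ t ω = o}) ∩
          {ω | o :: outcomeWord (fun s => ξ s ω) (t + 1) n ∈ S} :=
      fun o _ o' _ hne => Set.disjoint_left.mpr fun ω hω hω' =>
        hne (hω.1.2.symm.trans hω'.1.2)
    rw [hsplit, measureReal_biUnion_finset hdisjoint fun o _ =>
      (h.pastSigma_le _ _ _ (hpart o)).inter (hword o)]
    simp only [wordProb, wordMean, outcomeMean, Finset.mul_sum]
    refine Finset.sum_congr rfl fun o _ => ?_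
    rw [← mul_assoc, ← h.measureReal_inter_outcome hp hp1 hE o]
    exact ih (hpart o) {w | o :: w ∈ S}

end IsSweepingRandomness

end Past

/-! ### The position of the agent at the start of a phase -/

lemma guidedWalk_eq_agentDisp {x : ℕ → ℤ × ℤ} {l : List Dir}
    (hx : ∀ s ≤ l.length, x s = displacement (l.take s)) (y : ℕ → Outcome) {s : ℕ}
    (hs : s ≤ l.length) : guidedWalk x y s = agentDisp (l.take s) (outcomeWord y 0 s) := by
  induction s with
  | zero => simp [guidedWalk, agentDisp]
  | succ s ih =>
    have hs' : s < l.length := hs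
    have hinstruction : x (s + 1) - x s = l[s].vec := by
      rw [hx (s + 1) hs, hx s hs'.le, ← List.take_append_getElem hs', displacement_append,
        displacement_cons]
      simp [displacement]
    have hstep : agentDisp [l[s]] (outcomeWord y s 1) = step l[s] (y s) := add_zero _
    rw [guidedWalk, ih hs'.le, outcomeWord_add, ← List.take_append_getElem hs',
      agentDisp_append (by rw [length_outcomeWord, List.length_take, min_eq_left hs'.le]),
      zero_add, hstep, hinstruction]
    cases y s <;> rfl

lemma abs_agentDisp_le (l : List Dir) (w : List Outcome) :
    |(agentDisp l w).1| ≤ l.length ∧ |(agentDisp l w).2| ≤ l.length := by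
  induction l generalizing w with
  | nil => simp [agentDisp]
  | cons d l ih =>
    rcases w with _ | ⟨o, w⟩
    · simp only [agentDisp, List.zipWith_nil_right, List.sum_nil, Prod.fst_zero, Prod.snd_zero,
        abs_zero]
      exact ⟨Nat.cast_nonneg _, Nat.cast_nonneg _⟩
    · have hvec (d' : Dir) : |d'.vec.1| ≤ 1 ∧ |d'.vec.2| ≤ 1 := by cases d' <;> simp [Dir.vec]
      have hstep : |(step d o).1| ≤ 1 ∧ |(step d o).2| ≤ 1 := by cases o <;> exact hvec _
      rw [agentDisp_cons, Prod.fst_add, Prod.snd_add, List.length_cons, Nat.cast_succ]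
      have hfst := abs_add_le (step d o).1 (agentDisp l w).1
      have hsnd := abs_add_le (step d o).2 (agentDisp l w).2
      constructor <;> linarith [(ih w).1, (ih w).2]

section Walk

variable {p₀ A B : ℝ} {l₀ : List Dir}

lemma startTime_pos (hl₀ : 0 < l₀.length) (n : ℕ) : 0 < startTime p₀ A B l₀.length n := by
  induction n with
  | zero => exact hl₀
  | succ n ih => exact Nat.add_pos_left ih _

lemma boxW_pos (hp₀ : p₀ < 1) (hA : 0 < A) {t : ℕ} (ht : 0 < t) : 0 < boxW p₀ A t := by
  have := sub_pos.mpr hp₀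
  have : (0 : ℝ) < t := Nat.cast_pos.mpr ht
  exact Nat.ceil_pos.mpr (by positivity)

lemma maxShift_pos {t : ℕ} (ht : 0 < t) : 0 < maxShift p₀ t := by
  have : (0 : ℝ) < t := Nat.cast_pos.mpr ht
  exact Nat.add_pos_right _ (Nat.ceil_pos.mpr (by positivity))

lemma length_phase_pos (hp₀ : p₀ < 1) (hA : 0 < A) {t : ℕ} (ht : 0 < t) (z : ℕ) :
    0 < (phase p₀ A B t z).length := by
  have := boxW_pos hp₀ hA ht
  simp only [phase, sweep, List.length_append, List.length_replicate]
  omega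

lemma strictMono_startTime (hp₀ : p₀ < 1) (hA : 0 < A) (hl₀ : 0 < l₀.length) :
    StrictMono (startTime p₀ A B l₀.length) :=
  strictMono_nat_of_lt_succ fun n =>
    Nat.lt_add_of_pos_right (length_phase_pos hp₀ hA (startTime_pos hl₀ n) 0)

lemma le_length_moves (hp₀ : p₀ < 1) (hA : 0 < A) (hl₀ : 0 < l₀.length) (z : ℕ → ℕ) (n : ℕ) :
    n ≤ (moves p₀ A B l₀ z n).length := by
  induction n with
  | zero => exact Nat.zero_le _
  | succ n ih =>
    have := length_phase_pos (B := B) hp₀ hA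
      (startTime_pos (p₀ := p₀) (A := A) (B := B) hl₀ n) (z n)
    rw [moves, List.length_append]
    omega

lemma length_moves {z : ℕ → ℕ} {n : ℕ}
    (hz : ∀ j < n, z j ≤ maxShift p₀ (startTime p₀ A B l₀.length j)) :
    (moves p₀ A B l₀ z n).length = startTime p₀ A B l₀.length n := by
  induction n with
  | zero => rfl
  | succ n ih =>
    rw [moves, List.length_append, ih fun j hj => hz j (hj.trans n.lt_succ_self), startTime,
      length_phase _ _ _ _ _ (hz n n.lt_succ_self)]

lemma moves_congr {z z' : ℕ → ℕ} {n : ℕ} (h : ∀ j < n, z j = z' j) :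
    moves p₀ A B l₀ z n = moves p₀ A B l₀ z' n := by
  induction n with
  | zero => rfl
  | succ n ih =>
    rw [moves, moves, ih fun j hj => h j (hj.trans n.lt_succ_self), h n n.lt_succ_self]

lemma moves_prefix (z : ℕ → ℕ) {m n : ℕ} (h : m ≤ n) :
    moves p₀ A B l₀ z m <+: moves p₀ A B l₀ z n := by
  induction n, h using Nat.le_induction with
  | base => exact List.prefix_rfl
  | succ n _ ih => exact ih.trans (List.prefix_append _ _)

lemma sweepingInstructions_eq (hp₀ : p₀ < 1) (hA : 0 < A) (hl₀ : 0 < l₀.length) (z : ℕ → ℕ)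
    {n s : ℕ} (hs : s ≤ (moves p₀ A B l₀ z n).length) :
    sweepingInstructions p₀ A B l₀ z s = displacement ((moves p₀ A B l₀ z n).take s) := by
  have hs' := le_length_moves (B := B) hp₀ hA hl₀ z s
  rw [sweepingInstructions]
  rcases le_total s n with h | h <;> obtain ⟨r, hr⟩ := moves_prefix (A := A) (B := B) z h
  · rw [← hr, List.take_append_of_le_length hs']
  · rw [← hr, List.take_append_of_le_length hs]

variable (p₀ A B l₀) in
/-- The walk of the agent that follows the sweeping strategy, for given outcomes and shifts. -/
noncomputable def sweepingWalk (x : ℕ → Outcome) (z : ℕ → ℕ) : ℕ → ℤ × ℤ :=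
  guidedWalk (sweepingInstructions p₀ A B l₀ z) x

lemma sweepingWalk_eq_agentDisp (hp₀ : p₀ < 1) (hA : 0 < A) (hl₀ : 0 < l₀.length)
    (x : ℕ → Outcome) {z : ℕ → ℕ} {i s : ℕ} (hs : s ≤ (moves p₀ A B l₀ z i).length) :
    sweepingWalk p₀ A B l₀ x z s =
      agentDisp ((moves p₀ A B l₀ z i).take s) (outcomeWord x 0 s) :=
  guidedWalk_eq_agentDisp (fun _ h => sweepingInstructions_eq hp₀ hA hl₀ z h) x hs

lemma sweepingWalk_congr (hp₀ : p₀ < 1) (hA : 0 < A) (hl₀ : 0 < l₀.length)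
    {x x' : ℕ → Outcome} {z z' : ℕ → ℕ} {i s : ℕ} (hs : s ≤ (moves p₀ A B l₀ z i).length)
    (hx : ∀ r < s, x r = x' r) (hz : ∀ j < i, z j = z' j) :
    sweepingWalk p₀ A B l₀ x z s = sweepingWalk p₀ A B l₀ x' z' s := by
  rw [sweepingWalk_eq_agentDisp hp₀ hA hl₀ x hs,
    sweepingWalk_eq_agentDisp hp₀ hA hl₀ x' (hs.trans_eq (by rw [moves_congr hz])),
    moves_congr hz, outcomeWord_congr (by rwa [zero_add])]

lemma sweepingWalk_startTime_add (hp₀ : p₀ < 1) (hA : 0 < A) (hl₀ : 0 < l₀.length)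
    (x : ℕ → Outcome) {z : ℕ → ℕ} {i t k : ℕ} (ht : t = startTime p₀ A B l₀.length i)
    (hz : ∀ j < i, z j ≤ maxShift p₀ (startTime p₀ A B l₀.length j))
    (hk : k ≤ (phase p₀ A B t (z i)).length) :
    sweepingWalk p₀ A B l₀ x z (t + k) = sweepingWalk p₀ A B l₀ x z t +
      agentDisp ((phase p₀ A B t (z i)).take k) (outcomeWord x t k) := by
  have hlength : (moves p₀ A B l₀ z i).length = t := (length_moves hz).trans ht.symm
  have hmoves : moves p₀ A B l₀ z (i + 1) = moves p₀ A B l₀ z i ++ phase p₀ A B t (z i) := by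
    rw [moves, ht]
  have hend : t + k ≤ (moves p₀ A B l₀ z (i + 1)).length := by
    rw [hmoves, List.length_append, hlength]
    exact Nat.add_le_add_left hk t
  rw [sweepingWalk_eq_agentDisp hp₀ hA hl₀ x hend,
    sweepingWalk_eq_agentDisp hp₀ hA hl₀ x hlength.ge, outcomeWord_add, zero_add, hmoves,
    List.take_of_length_le hlength.le]
  nth_rewrite 1 [← hlength]
  rw [List.take_length_add_append]
  exact agentDisp_append (by rw [length_outcomeWord, hlength])

/-- A finite set of lattice points that contains every position that can be reached in time `t`. -/
noncomputable def reachable (t : ℕ) : Finset (ℤ × ℤ) :=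
  Finset.Icc (-(t : ℤ)) t ×ˢ Finset.Icc (-(t : ℤ)) t

lemma sweepingWalk_mem_reachable (hp₀ : p₀ < 1) (hA : 0 < A) (hl₀ : 0 < l₀.length)
    (x : ℕ → Outcome) (z : ℕ → ℕ) (s : ℕ) : sweepingWalk p₀ A B l₀ x z s ∈ reachable s := by
  rw [sweepingWalk_eq_agentDisp hp₀ hA hl₀ x (le_length_moves hp₀ hA hl₀ z s), reachable,
    Finset.mem_product, Finset.mem_Icc, Finset.mem_Icc, ← abs_le, ← abs_le]
  have hlength : (((moves p₀ A B l₀ z s).take s).length : ℤ) ≤ s :=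
    Nat.cast_le.mpr (List.length_take_le _ _)
  exact (abs_agentDisp_le _ _).imp hlength.trans' hlength.trans'

variable (p₀ A B l₀) in
/-- The shifts of the phases before phase `i` are in their ranges, and the agent has not yet been at
`home` when phase `i` starts, and is then at `v`. -/
def Survives (home : ℤ × ℤ) (x : ℕ → Outcome) (z : ℕ → ℕ) (i : ℕ) (v : ℤ × ℤ) : Prop :=
  (∀ j < i, z j ∈ Finset.Icc 1 (maxShift p₀ (startTime p₀ A B l₀.length j))) ∧
    (∀ s ≤ startTime p₀ A B l₀.length i, sweepingWalk p₀ A B l₀ x z s ≠ home) ∧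
    sweepingWalk p₀ A B l₀ x z (startTime p₀ A B l₀.length i) = v

lemma Survives.exists_of_succ {home y : ℤ × ℤ} {x : ℕ → Outcome} {z : ℕ → ℕ} {i t : ℕ}
    (h : Survives p₀ A B l₀ home x z (i + 1) y) (hp₀ : p₀ < 1) (hA : 0 < A) (hl₀ : 0 < l₀.length)
    (ht : t = startTime p₀ A B l₀.length i) :
    ∃ v ∈ reachable t, Survives p₀ A B l₀ home x z i v ∧ z i ∈ Finset.Icc 1 (maxShift p₀ t) ∧
      ¬ Hits v home (phase p₀ A B t (z i)) (outcomeWord x t (phaseLength p₀ A B t)) ∧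
      v + agentDisp (phase p₀ A B t (z i)) (outcomeWord x t (phaseLength p₀ A B t)) = y := by
  obtain ⟨hz, havoid, hy⟩ := h
  rw [startTime, ← ht] at havoid hy
  have hzi : z i ∈ Finset.Icc 1 (maxShift p₀ t) := ht ▸ hz i i.lt_succ_self
  have hlength : (phase p₀ A B t (z i)).length = phaseLength p₀ A B t :=
    length_phase _ _ _ _ _ (Finset.mem_Icc.mp hzi).2
  have hz' (j) (hj : j < i) := hz j (hj.trans i.lt_succ_self)
  have hwalk {k : ℕ} (hk : k ≤ (phase p₀ A B t (z i)).length) :=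
    sweepingWalk_startTime_add hp₀ hA hl₀ x ht (fun j hj => (Finset.mem_Icc.mp (hz' j hj)).2) hk
  refine ⟨_, sweepingWalk_mem_reachable hp₀ hA hl₀ x z t,
    ⟨hz', fun s hs => havoid s (hs.trans (by omega)), by rw [ht]⟩, hzi, ?_, ?_⟩
  · rintro ⟨k, hk, hhome⟩
    rw [← agentDisp_take_right _ (List.length_take_le k _),
      take_outcomeWord _ _ (hk.trans_eq hlength), ← hwalk hk] at hhome
    exact havoid _ (by omega) hhome
  · rw [← hy, hwalk hlength.ge, ← hlength, List.take_length]

lemma Survives.congr {home v : ℤ × ℤ} {x x' : ℕ → Outcome} {z z' : ℕ → ℕ} {i : ℕ}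
    (h : Survives p₀ A B l₀ home x z i v) (hp₀ : p₀ < 1) (hA : 0 < A) (hl₀ : 0 < l₀.length)
    (hx : ∀ s < startTime p₀ A B l₀.length i, x s = x' s) (hz : ∀ j < i, z j = z' j) :
    Survives p₀ A B l₀ home x' z' i v := by
  obtain ⟨hshift, havoid, hv⟩ := h
  have hlength := length_moves fun j hj => (Finset.mem_Icc.mp (hshift j hj)).2
  have hwalk (s) (hs : s ≤ startTime p₀ A B l₀.length i) :
      sweepingWalk p₀ A B l₀ x z s = sweepingWalk p₀ A B l₀ x' z' s :=
    sweepingWalk_congr hp₀ hA hl₀ (hs.trans hlength.ge) (fun r hr => hx r (hr.trans_le hs)) hz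
  exact ⟨fun j hj => hz j hj ▸ hshift j hj, fun s hs => hwalk s hs ▸ havoid s hs,
    hwalk _ le_rfl ▸ hv⟩

end Walk

/-! ### The agent that has not yet been at home -/

lemma sum_wordProb_mul_le_wordMean {p : ℝ} (hp : 0 ≤ p) (hp1 : p ≤ 1) {α : Type*} (R : Finset α)
    (n : ℕ) (S : Set (List Outcome)) (f : List Outcome → α) {φ : α → ℝ} (hφ : ∀ v, 0 ≤ φ v) :
    ∑ y ∈ R, wordProb p n {w | w ∈ S ∧ f w = y} * φ y ≤
      wordMean p n (S.indicator fun w => φ (f w)) := by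
  classical
  calc ∑ y ∈ R, wordProb p n {w | w ∈ S ∧ f w = y} * φ y
      = wordMean p n fun w => ∑ y ∈ R, φ y * {w | w ∈ S ∧ f w = y}.indicator 1 w := by
        simp only [wordMean_sum, wordMean_mul_left, wordProb, mul_comm _ (φ _)]
    _ ≤ wordMean p n (S.indicator fun w => φ (f w)) := by
        refine wordMean_mono hp hp1 fun w _ => ?_
        by_cases hw : w ∈ S
        · simp only [Set.indicator_apply, Set.mem_ofPred_eq, hw, true_and, Pi.one_apply, mul_ite,
            mul_one, mul_zero, Finset.sum_ite_eq, if_true]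
          split_ifs
          exacts [le_rfl, hφ _]
        · simp [hw]

section Survival

variable {Ω : Type*} [MeasurableSpace Ω] {μ : Measure Ω} {p p₀ A B : ℝ} {l₀ : List Dir}
  {ξ : ℕ → Ω → Outcome} {Z : ℕ → Ω → ℕ}

variable (p₀ A B l₀ ξ Z) in
/-- The event that the agent has not yet been at `home` when phase `i` starts, and is then at `v`;
see `Survives`. -/
def survivalEvent (home : ℤ × ℤ) (i : ℕ) (v : ℤ × ℤ) : Set Ω :=
  {ω | Survives p₀ A B l₀ home (fun s => ξ s ω) (fun j => Z j ω) i v}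

variable (p₀ A B l₀ μ ξ Z) in
/-- The mean of `φ (position at the start of phase i)` on the event that the agent has not yet been
at `home` by then. -/
noncomputable def survivalMean (home : ℤ × ℤ) (i : ℕ) (φ : ℤ × ℤ → ℝ) : ℝ :=
  ∑ v ∈ reachable (startTime p₀ A B l₀.length i),
    μ.real (survivalEvent p₀ A B l₀ ξ Z home i v) * φ v

lemma survivalMean_mono (home : ℤ × ℤ) (i : ℕ) {φ ψ : ℤ × ℤ → ℝ} (h : ∀ v, φ v ≤ ψ v) :
    survivalMean μ p₀ A B l₀ ξ Z home i φ ≤ survivalMean μ p₀ A B l₀ ξ Z home i ψ :=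
  Finset.sum_le_sum fun v _ => mul_le_mul_of_nonneg_left (h v) measureReal_nonneg

namespace IsSweepingRandomness

lemma measureReal_survivalEvent_succ_le [IsProbabilityMeasure μ]
    (h : IsSweepingRandomness μ p p₀ A B l₀.length ξ Z) (hp₀ : p₀ < 1) (hA : 0 < A)
    (hl₀ : 0 < l₀.length) (hp : 0 ≤ p) (hp1 : p ≤ 1) (home : ℤ × ℤ) {i t : ℕ}
    (ht : t = startTime p₀ A B l₀.length i) (y : ℤ × ℤ) :
    μ.real (survivalEvent p₀ A B l₀ ξ Z home (i + 1) y) ≤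
      ∑ v ∈ reachable t, ∑ z ∈ Finset.Icc 1 (maxShift p₀ t),
        μ.real (survivalEvent p₀ A B l₀ ξ Z home i v) / maxShift p₀ t *
          wordProb p (phaseLength p₀ A B t) {w | w ∈ {w | Hits v home (phase p₀ A B t z) w}ᶜ ∧
            v + agentDisp (phase p₀ A B t z) w = y} := by
  set S := survivalEvent p₀ A B l₀ ξ Z home i
  set L := phaseLength p₀ A B t
  have hmeas (v) : MeasurableSet[pastSigma ξ Z t i] (S v) :=
    measurableSet_pastSigma (Q := fun x z => Survives p₀ A B l₀ home x z i v)
      fun x x' z z' hx hz hS => hS.congr hp₀ hA hl₀ (ht ▸ hx) hz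
  have hmeas_shift (v) (z : ℕ) :
      MeasurableSet[pastSigma ξ Z t (i + 1)] (S v ∩ {ω | Z i ω = z}) :=
    measurableSet_pastSigma (Q := fun x y => Survives p₀ A B l₀ home x y i v ∧ y i = z)
      fun x x' y y' hx hy ⟨hS, hz⟩ =>
        ⟨hS.congr hp₀ hA hl₀ (ht ▸ hx) fun j hj => hy j (hj.trans i.lt_succ_self),
          hy i i.lt_succ_self ▸ hz⟩
  have hsubset : survivalEvent p₀ A B l₀ ξ Z home (i + 1) y ⊆
      ⋃ v ∈ reachable t, ⋃ z ∈ Finset.Icc 1 (maxShift p₀ t), (S v ∩ {ω | Z i ω = z}) ∩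
        {ω | outcomeWord (fun s => ξ s ω) t L ∈
          {w | w ∈ {w | Hits v home (phase p₀ A B t z) w}ᶜ ∧
            v + agentDisp (phase p₀ A B t z) w = y}} := by
    intro ω hω
    obtain ⟨v, hv, hS, hz, hmiss, hend⟩ := Survives.exists_of_succ hω hp₀ hA hl₀ ht
    exact Set.mem_iUnion₂_of_mem hv (Set.mem_iUnion₂_of_mem hz ⟨⟨hS, rfl⟩, hmiss, hend⟩)
  refine (measureReal_mono hsubset (measure_ne_top _ _)).trans ?_
  refine (measureReal_biUnion_finset_le _ _).trans ?_
  refine Finset.sum_le_sum fun v _ => (measureReal_biUnion_finset_le _ _).trans_eq ?_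
  refine Finset.sum_congr rfl fun z hz => ?_
  rw [h.measureReal_inter_outcomeWord hp hp1 (hmeas_shift v z),
    h.measureReal_inter_shift (hmeas v) (ht ▸ hz), ht]

lemma survivalMean_succ_le [IsProbabilityMeasure μ]
    (h : IsSweepingRandomness μ p p₀ A B l₀.length ξ Z) (hp₀ : p₀ < 1) (hA : 0 < A)
    (hl₀ : 0 < l₀.length) (hp : 0 ≤ p) (hp1 : p ≤ 1) (home : ℤ × ℤ) {i t : ℕ}
    (ht : t = startTime p₀ A B l₀.length i) {φ : ℤ × ℤ → ℝ} (hφ : ∀ v, 0 ≤ φ v) :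
    survivalMean μ p₀ A B l₀ ξ Z home (i + 1) φ ≤
      survivalMean μ p₀ A B l₀ ξ Z home i fun v => (∑ z ∈ Finset.Icc 1 (maxShift p₀ t),
        wordMean p (phaseLength p₀ A B t) ({w | Hits v home (phase p₀ A B t z) w}ᶜ.indicator
          fun w => φ (v + agentDisp (phase p₀ A B t z) w))) / maxShift p₀ t := by
  set S := survivalEvent p₀ A B l₀ ξ Z home i
  set L := phaseLength p₀ A B t
  set M := maxShift p₀ t
  set miss : ℤ × ℤ → ℕ → Set (List Outcome) := fun v z => {w | Hits v home (phase p₀ A B t z) w}ᶜ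
  set land : ℤ × ℤ → ℕ → List Outcome → ℤ × ℤ := fun v z w => v + agentDisp (phase p₀ A B t z) w
  set R := reachable (startTime p₀ A B l₀.length (i + 1))
  calc survivalMean μ p₀ A B l₀ ξ Z home (i + 1) φ
      ≤ ∑ y ∈ R, (∑ v ∈ reachable t, ∑ z ∈ Finset.Icc 1 M, μ.real (S v) / M *
          wordProb p L {w | w ∈ miss v z ∧ land v z w = y}) * φ y :=
        Finset.sum_le_sum fun y _ => mul_le_mul_of_nonneg_right
          (h.measureReal_survivalEvent_succ_le hp₀ hA hl₀ hp hp1 home ht y) (hφ y)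
    _ = ∑ v ∈ reachable t, ∑ z ∈ Finset.Icc 1 M, μ.real (S v) / M *
          ∑ y ∈ R, wordProb p L {w | w ∈ miss v z ∧ land v z w = y} * φ y := by
        simp only [Finset.sum_mul, Finset.mul_sum, mul_assoc]
        rw [Finset.sum_comm]
        exact Finset.sum_congr rfl fun v _ => Finset.sum_comm
    _ ≤ ∑ v ∈ reachable t, ∑ z ∈ Finset.Icc 1 M, μ.real (S v) / M *
          wordMean p L ((miss v z).indicator fun w => φ (land v z w)) := by
        gcongr with v _ z _
        exact sum_wordProb_mul_le_wordMean hp hp1 R L _ _ hφ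
    _ = _ := by
        rw [survivalMean, ← ht]
        refine Finset.sum_congr rfl fun v _ => ?_
        rw [← Finset.mul_sum, div_mul_eq_mul_div, mul_div_assoc]

lemma measureReal_lt_sweepingTime_le [IsProbabilityMeasure μ]
    (h : IsSweepingRandomness μ p p₀ A B l₀.length ξ Z) (hp₀ : p₀ < 1) (hA : 0 < A)
    (hl₀ : 0 < l₀.length) (home : ℤ × ℤ) (i : ℕ) :
    μ.real {ω | (startTime p₀ A B l₀.length i : ℕ∞) < sweepingTime p₀ A B l₀ ξ Z home ω} ≤
      survivalMean μ p₀ A B l₀ ξ Z home i fun _ => 1 := by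
  have hae : ({ω | (startTime p₀ A B l₀.length i : ℕ∞) < sweepingTime p₀ A B l₀ ξ Z home ω} :
      Set Ω) ≤ᵐ[μ] (⋃ v ∈ reachable (startTime p₀ A B l₀.length i),
        survivalEvent p₀ A B l₀ ξ Z home i v : Set Ω) := by
    filter_upwards [h.ae_shift_mem fun i => maxShift_pos (startTime_pos hl₀ i)] with ω hω hlt
    refine Set.mem_iUnion₂_of_mem (sweepingWalk_mem_reachable hp₀ hA hl₀ _ _ _)
      ⟨fun j _ => hω j, fun s hs hhome => ?_, rfl⟩
    exact not_lt_of_ge ((iInf₂_le s hhome).trans (Nat.cast_le.mpr hs)) hlt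
  refine (ENNReal.toReal_mono (measure_ne_top _ _) (measure_mono_ae hae)).trans ?_
  refine (measureReal_biUnion_finset_le _ _).trans_eq ?_
  simp only [survivalMean, mul_one]

end IsSweepingRandomness

end Survival

lemma wordProb_compl {p : ℝ} (n : ℕ) (S : Set (List Outcome)) :
    wordProb p n Sᶜ = 1 - wordProb p n S := by
  rw [wordProb, wordProb, ← wordMean_const (p := p) n 1, ← wordMean_sub, Set.indicator_compl]
  rfl

section Recursion

variable {Ω : Type*} [MeasurableSpace Ω] {μ : Measure Ω} {p p₀ A B : ℝ} {l₀ : List Dir}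
  {ξ : ℕ → Ω → Outcome} {Z : ℕ → Ω → ℕ}

lemma survivalMean_nonneg (home : ℤ × ℤ) (i : ℕ) {φ : ℤ × ℤ → ℝ} (hφ : ∀ v, 0 ≤ φ v) :
    0 ≤ survivalMean μ p₀ A B l₀ ξ Z home i φ :=
  Finset.sum_nonneg fun v _ => mul_nonneg measureReal_nonneg (hφ v)

lemma survivalMean_mul_left (home : ℤ × ℤ) (i : ℕ) (c : ℝ) (φ : ℤ × ℤ → ℝ) :
    survivalMean μ p₀ A B l₀ ξ Z home i (fun v => c * φ v) =
      c * survivalMean μ p₀ A B l₀ ξ Z home i φ := by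
  simp only [survivalMean, Finset.mul_sum, mul_left_comm c]

lemma survivalMean_add (home : ℤ × ℤ) (i : ℕ) (φ ψ : ℤ × ℤ → ℝ) :
    survivalMean μ p₀ A B l₀ ξ Z home i (fun v => φ v + ψ v) =
      survivalMean μ p₀ A B l₀ ξ Z home i φ + survivalMean μ p₀ A B l₀ ξ Z home i ψ := by
  simp only [survivalMean, mul_add, Finset.sum_add_distrib]

lemma survivalMean_sum {ι : Type*} (T : Finset ι) (home : ℤ × ℤ) (i : ℕ)
    (φ : ι → ℤ × ℤ → ℝ) :
    survivalMean μ p₀ A B l₀ ξ Z home i (fun v => ∑ e ∈ T, φ e v) =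
      ∑ e ∈ T, survivalMean μ p₀ A B l₀ ξ Z home i (φ e) := by
  simp only [survivalMean, Finset.mul_sum]
  exact Finset.sum_comm

lemma wordMean_exp_comp_add_le (hp : 0 ≤ p) (hp1 : p ≤ 1) {s : ℝ} (hs : 0 ≤ s) (hs1 : s ≤ 1 / 2)
    (e : Dir) (v : ℤ × ℤ) {l : List Dir} (hl : displacement l = 0) (S : Set (List Outcome)) :
    wordMean p l.length (S.indicator fun w => Real.exp (s * e.comp (v + agentDisp l w))) ≤
      Real.exp (s ^ 2 * ((l.map (stepVar p e)).sum / 2 + 8 * s * l.length)) *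
        Real.exp (s * e.comp v) := by
  have hexp := wordMean_exp_le hp hp1 hs hs1 e l
  rw [hl, show e.comp (0 : ℤ × ℤ) = 0 by simp [Dir.comp], Int.cast_zero, mul_zero] at hexp
  rw [mul_comm]
  refine le_trans ?_ (mul_le_mul_of_nonneg_left hexp (Real.exp_pos _).le)
  rw [← wordMean_mul_left]
  refine wordMean_mono hp hp1 fun w _ => ?_
  refine (Set.indicator_le_self' (fun _ _ => (Real.exp_pos _).le) w).trans_eq ?_
  rw [← Real.exp_add, Dir.comp_add, Int.cast_add, sub_zero, mul_add]

lemma one_le_mul_sum_exp {r s : Dir → ℝ} {γ : ℝ} (hs : ∀ e, 0 ≤ s e)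
    (hγ : ∀ e, γ = Real.exp (-(s e * r e))) {v : ℤ × ℤ} (hv : ∃ e : Dir, r e ≤ e.comp v) :
    1 ≤ γ * ∑ e, Real.exp (s e * e.comp v) := by
  obtain ⟨e, he⟩ := hv
  calc 1 ≤ γ * Real.exp (s e * e.comp v) := by
        rw [hγ e, ← Real.exp_add]
        exact Real.one_le_exp (by linarith [mul_le_mul_of_nonneg_left he (hs e)])
    _ ≤ γ * ∑ e, Real.exp (s e * e.comp v) := by
        refine mul_le_mul_of_nonneg_left ?_ ((hγ e).symm ▸ (Real.exp_pos _).le)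
        exact Finset.single_le_sum (f := fun e : Dir => Real.exp (s e * e.comp v))
          (fun _ _ => (Real.exp_pos _).le) (Finset.mem_univ e)

namespace IsSweepingRandomness

variable [IsProbabilityMeasure μ]

lemma survivalMean_exp_succ_le (h : IsSweepingRandomness μ p p₀ A B l₀.length ξ Z)
    (hp₀ : p₀ < 1) (hA : 0 < A) (hl₀ : 0 < l₀.length) (hp : 0 ≤ p) (hp1 : p ≤ 1) (home : ℤ × ℤ)
    {i t : ℕ} (ht : t = startTime p₀ A B l₀.length i) {s c : ℝ} (hs : 0 ≤ s) (hs1 : s ≤ 1 / 2)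
    (e : Dir) (hc : ∀ z ≤ maxShift p₀ t,
      ((phase p₀ A B t z).map (stepVar p e)).sum ≤ c * phaseLength p₀ A B t) :
    survivalMean μ p₀ A B l₀ ξ Z home (i + 1) (fun v => Real.exp (s * e.comp v)) ≤
      Real.exp (s ^ 2 * ((c / 2 + 8 * s) * phaseLength p₀ A B t)) *
        survivalMean μ p₀ A B l₀ ξ Z home i (fun v => Real.exp (s * e.comp v)) := by
  have hM : (0 : ℝ) < maxShift p₀ t := Nat.cast_pos.mpr (maxShift_pos (ht ▸ startTime_pos hl₀ i))
  refine (h.survivalMean_succ_le hp₀ hA hl₀ hp hp1 home ht fun _ => (Real.exp_pos _).le).trans ?_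
  rw [← survivalMean_mul_left]
  refine survivalMean_mono home i fun v => ?_
  rw [div_le_iff₀ hM, mul_comm _ (maxShift p₀ t : ℝ), ← nsmul_eq_mul]
  refine (Finset.sum_le_card_nsmul _ _ (Real.exp _ * Real.exp _) fun z hz => ?_).trans_eq
    (by rw [Nat.card_Icc, Nat.add_sub_cancel])
  have hzM := (Finset.mem_Icc.mp hz).2
  rw [← length_phase p₀ A B t z hzM]
  refine (wordMean_exp_comp_add_le hp hp1 hs hs1 e v (displacement_phase p₀ A B t z) _).trans ?_
  gcongr
  have := hc z hzM
  rw [length_phase p₀ A B t z hzM]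
  linarith

lemma survivalMean_one_succ_le (h : IsSweepingRandomness μ p p₀ A B l₀.length ξ Z)
    (hp₀ : p₀ < 1) (hA : 0 < A) (hl₀ : 0 < l₀.length) (hp : 0 ≤ p) (hp1 : p ≤ 1) (home : ℤ × ℤ)
    {i t : ℕ} (ht : t = startTime p₀ A B l₀.length i) {η : ℝ} (hη : η ≤ 1) {r s : Dir → ℝ} {γ : ℝ}
    (hs : ∀ e, 0 ≤ s e) (hγ : ∀ e, γ = Real.exp (-(s e * r e)))
    (hhit : ∀ x : ℤ × ℤ, (∀ e : Dir, (e.comp x : ℝ) ≤ r e) →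
      1 - η ≤ ∑ z ∈ Finset.Icc 1 (maxShift p₀ t),
        wordProb p (phaseLength p₀ A B t) {w | Hits x home (phase p₀ A B t z) w}) :
    survivalMean μ p₀ A B l₀ ξ Z home (i + 1) (fun _ => 1) ≤
      (1 - (1 - η) / maxShift p₀ t) * survivalMean μ p₀ A B l₀ ξ Z home i (fun _ => 1) +
      (1 - η) / maxShift p₀ t * (γ * ∑ e, survivalMean μ p₀ A B l₀ ξ Z home i
        (fun v => Real.exp (s e * e.comp v))) := by
  have hM : (0 : ℝ) < maxShift p₀ t := Nat.cast_pos.mpr (maxShift_pos (ht ▸ startTime_pos hl₀ i))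
  set κ := (1 - η) / maxShift p₀ t
  have hκ : 0 ≤ κ := div_nonneg (sub_nonneg.mpr hη) hM.le
  set P : ℤ × ℤ → ℕ → ℝ := fun v z =>
    wordProb p (phaseLength p₀ A B t) {w | Hits v home (phase p₀ A B t z) w} with hP
  have hmiss (v) : ∑ z ∈ Finset.Icc 1 (maxShift p₀ t), wordMean p (phaseLength p₀ A B t)
      ({w | Hits v home (phase p₀ A B t z) w}ᶜ.indicator fun _ => 1) =
      maxShift p₀ t - ∑ z ∈ Finset.Icc 1 (maxShift p₀ t), P v z := by
    change ∑ z ∈ _, wordProb _ _ _ᶜ = _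
    simp only [wordProb_compl, Finset.sum_sub_distrib, hP, Finset.sum_const, Nat.card_Icc,
      Nat.add_sub_cancel, nsmul_eq_mul, mul_one]
  refine (h.survivalMean_succ_le hp₀ hA hl₀ hp hp1 home ht fun _ => zero_le_one).trans ?_
  rw [← survivalMean_sum, ← survivalMean_mul_left, ← survivalMean_mul_left,
    ← survivalMean_mul_left, ← survivalMean_add]
  refine survivalMean_mono home i fun v => ?_
  rw [hmiss, sub_div, div_self hM.ne', mul_one]
  by_cases hv : ∃ e : Dir, r e ≤ e.comp v
  · have hfar := mul_le_mul_of_nonneg_left (one_le_mul_sum_exp hs hγ hv) hκ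
    have hP0 : 0 ≤ (∑ z ∈ Finset.Icc 1 (maxShift p₀ t), P v z) / maxShift p₀ t :=
      div_nonneg (Finset.sum_nonneg fun z _ => wordMean_nonneg hp hp1 fun w _ =>
        Set.indicator_nonneg (fun _ _ => zero_le_one) w) hM.le
    linarith
  · push Not at hv
    have hnear : κ ≤ (∑ z ∈ Finset.Icc 1 (maxShift p₀ t), P v z) / maxShift p₀ t :=
      div_le_div_of_nonneg_right (hhit v fun e => (hv e).le) hM.le
    have hγ0 : 0 < γ := hγ .east ▸ Real.exp_pos _
    have : 0 ≤ κ * (γ * ∑ e, Real.exp (s e * e.comp v)) := by positivity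
    linarith

end IsSweepingRandomness

/-- The weighted AM–GM inequality `(y / K) ^ ρ * 1 ^ (1 - ρ) ≤ ρ * (y / K) + (1 - ρ)`. -/
lemma rpow_le_mul_add {ρ K y : ℝ} (hK : 0 < K) (hρ : 0 ≤ ρ) (hρ1 : ρ ≤ 1) (hy : 0 ≤ y) :
    y ^ ρ ≤ ρ * K ^ (ρ - 1) * y + (1 - ρ) * K ^ ρ := by
  have hamgm := Real.geom_mean_le_arith_mean2_weighted hρ (sub_nonneg.mpr hρ1)
    (div_nonneg hy hK.le) zero_le_one (add_sub_cancel ρ 1)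
  rw [Real.one_rpow, mul_one, mul_one, Real.div_rpow hy hK.le,
    div_le_iff₀ (Real.rpow_pos_of_pos hK ρ)] at hamgm
  refine hamgm.trans_eq ?_
  rw [Real.rpow_sub_one hK.ne']
  ring

lemma survivalMean_exp_mul_le (home : ℤ × ℤ) (i : ℕ) (e : Dir) {s ρ K : ℝ} (hK : 0 < K)
    (hρ : 0 ≤ ρ) (hρ1 : ρ ≤ 1) :
    survivalMean μ p₀ A B l₀ ξ Z home i (fun v => Real.exp (ρ * s * e.comp v)) ≤
      ρ * K ^ (ρ - 1) * survivalMean μ p₀ A B l₀ ξ Z home i (fun v => Real.exp (s * e.comp v)) +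
      (1 - ρ) * K ^ ρ * survivalMean μ p₀ A B l₀ ξ Z home i (fun _ => 1) := by
  rw [← survivalMean_mul_left, ← survivalMean_mul_left, ← survivalMean_add]
  refine survivalMean_mono home i fun v => ?_
  rw [mul_assoc, mul_comm ρ, Real.exp_mul, mul_one]
  exact rpow_le_mul_add hK hρ hρ1 (Real.exp_pos _).le

end Recursion

/-! ### Decay of the survival probability -/

section Extent

variable {p p₀ a A B : ℝ}

lemma stepVar_le_mul (hp : 0 ≤ p) (hp1 : p ≤ 1) (e d : Dir) :
    stepVar p e d ≤ p / 2 * (3 - 2 * p) := by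
  rw [stepVar_eq]
  split_ifs
  · exact le_rfl
  · nlinarith

lemma div_two_mul_three_sub_le (hpp₀ : p ≤ p₀) (hp₀ : p₀ < 1) :
    p / 2 * (3 - 2 * p) ≤ ((1 - p) / (1 - p₀)) ^ 2 * (p₀ / 2 * (3 - 2 * p₀)) := by
  have : 0 < 1 - p₀ := sub_pos.mpr hp₀
  rw [div_pow, div_mul_eq_mul_div ((1 - p) ^ 2), le_div_iff₀ (by positivity)]
  have hdiff : 0 ≤ (p₀ - p) * ((2 - p₀) * (2 - p) - 1) :=
    mul_nonneg (sub_nonneg.mpr hpp₀) (by nlinarith)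
  nlinarith

lemma sweptExtent_pos (hp₀ : p₀ < 1) (hA : 0 < A) (hB : 0 < B) (hp1 : p < 1) (e : Dir) :
    0 < sweptExtent p p₀ A B e := by
  rw [sweptExtent]
  have := sub_pos.mpr hp₀
  have := sub_pos.mpr hp1
  split_ifs <;> positivity

lemma mul_le_sweptExtent_sq_div {v D : ℝ} (ha : 0 < a) (hD : a ^ 2 * v ≤ D ^ 2) :
    ((1 - p) / (1 - p₀)) ^ 2 * v ≤ ((1 - p) / (1 - p₀) * D) ^ 2 / a ^ 2 := by
  rw [mul_pow, mul_div_assoc]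
  gcongr
  rwa [le_div_iff₀' (by positivity)]

lemma eventually_sum_stepVar_le {ε : ℝ} (hp₀ : p₀ < 1) (ha : 0 < a) (hA : 0 < A) (hB : 0 < B)
    (hAa : a ^ 2 * (p₀ / 2 * (3 - 2 * p₀)) ≤ A ^ 2) (hBa : a ^ 2 * (p₀ / 2) ≤ B ^ 2)
    (hp : 0 ≤ p) (hpp₀ : p ≤ p₀) (hε : 0 < ε) (e : Dir) :
    ∀ᶠ t : ℕ in atTop, ∀ z ≤ maxShift p₀ t,
      ((phase p₀ A B t z).map (stepVar p e)).sum ≤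
        (sweptExtent p p₀ A B e ^ 2 / a ^ 2 + ε) * phaseLength p₀ A B t := by
  have hp1 : p ≤ 1 := hpp₀.trans hp₀.le
  have hq : 0 < 1 - p₀ := sub_pos.mpr hp₀
  by_cases he : e.Vertical
  · rw [sweptExtent, if_pos he]
    filter_upwards [eventually_vertical_le hp₀ hA hB hε] with t ht z hz
    have hvar := sum_stepVar_vertical_le hp hp1 he (phase p₀ A B t z)
    have hcount : (verticalCount (phase p₀ A B t z) : ℝ) ≤
        2 * (boxH p₀ B t + maxShift p₀ t + numLines p₀ B t * gap p₀ t) := by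
      exact_mod_cast verticalCount_phase_le p₀ A B hz
    have hratio : 1 ≤ ((1 - p) / (1 - p₀)) ^ 2 :=
      one_le_pow₀ ((one_le_div hq).mpr (by linarith))
    have hext : p / 2 ≤ ((1 - p) / (1 - p₀) * B) ^ 2 / a ^ 2 :=
      le_trans (by nlinarith) (mul_le_sweptExtent_sq_div ha hBa)
    rw [length_phase p₀ A B t z hz] at hvar
    linarith [mul_le_mul_of_nonneg_right hext (Nat.cast_nonneg (α := ℝ) (phaseLength p₀ A B t))]
  · rw [sweptExtent, if_neg he]
    refine Eventually.of_forall fun t z hz => ?_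
    have hvar := ((phase p₀ A B t z).map (stepVar p e)).sum_le_card_nsmul
      (p / 2 * (3 - 2 * p)) (by simp [stepVar_le_mul hp hp1])
    rw [List.length_map, length_phase p₀ A B t z hz, nsmul_eq_mul, mul_comm] at hvar
    refine hvar.trans (mul_le_mul_of_nonneg_right ?_ (Nat.cast_nonneg _))
    have hext := mul_le_sweptExtent_sq_div (p := p) (p₀ := p₀) ha hAa
    linarith [div_two_mul_three_sub_le hpp₀ hp₀]

/-- The exponent of the moments that measure how far the agent is out in the direction `e` at time
`t`. With it, being outside the swept box makes the exponential moment at least `exp (a ^ 2 / 2)`,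
on the scale `√t` on which a phase multiplies the moment only by a factor close to one. -/
noncomputable def tilt (p p₀ a A B : ℝ) (e : Dir) (t : ℕ) : ℝ :=
  a ^ 2 / (2 * sweptExtent p p₀ A B e * √(t : ℝ))

lemma tilt_nonneg (hp₀ : p₀ < 1) (hA : 0 < A) (hB : 0 < B) (hp1 : p < 1) (e : Dir) (t : ℕ) :
    0 ≤ tilt p p₀ a A B e t := by
  have := sweptExtent_pos hp₀ hA hB hp1 e
  rw [tilt]
  positivity

lemma tendsto_tilt (e : Dir) : Tendsto (tilt p p₀ a A B e) atTop (nhds 0) := by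
  refine (tendsto_sqrt_natCast.const_div_atTop (a ^ 2 / (2 * sweptExtent p p₀ A B e))).congr
    fun t => ?_
  rw [tilt, div_div]

lemma sqrt_div_mul_tilt {t : ℕ} (ht : 0 < t) (e : Dir) (t' : ℕ) :
    √((t : ℝ) / t') * tilt p p₀ a A B e t = tilt p p₀ a A B e t' := by
  have := Real.sqrt_pos.mpr (Nat.cast_pos (α := ℝ).mpr ht)
  rw [tilt, tilt, Real.sqrt_div t.cast_nonneg]
  field_simp

lemma tilt_mul_mul_sqrt (hp₀ : p₀ < 1) (hA : 0 < A) (hB : 0 < B) (hp1 : p < 1) (ε : ℝ) (e : Dir)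
    {t : ℕ} (ht : 0 < t) :
    tilt p p₀ a A B e t * ((1 - ε) * sweptExtent p p₀ A B e * √(t : ℝ)) =
      (1 - ε) * a ^ 2 / 2 := by
  have := sweptExtent_pos hp₀ hA hB hp1 e
  have := Real.sqrt_pos.mpr (Nat.cast_pos (α := ℝ).mpr ht)
  rw [tilt]
  field_simp

lemma tilt_sq_mul_le {ε v L : ℝ} (hp₀ : p₀ < 1) (ha : 0 < a) (hA : 0 < A) (hB : 0 < B)
    (hp1 : p < 1) (e : Dir) {t : ℕ} (hv : v = sweptExtent p p₀ A B e ^ 2 / a ^ 2) (hL : 0 ≤ L)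
    (htilt : tilt p p₀ a A B e t ≤ ε * v / 32) :
    tilt p p₀ a A B e t ^ 2 * (((v + ε * v / 2) / 2 + 8 * tilt p p₀ a A B e t) * L) ≤
      (1 + ε) * a ^ 2 / 8 * (L / t) := by
  have hr := sweptExtent_pos hp₀ hA hB hp1 e
  calc tilt p p₀ a A B e t ^ 2 * (((v + ε * v / 2) / 2 + 8 * tilt p p₀ a A B e t) * L)
      ≤ tilt p p₀ a A B e t ^ 2 * ((1 + ε) / 2 * v * L) := by
        gcongr
        linarith
    _ = (1 + ε) * a ^ 2 / 8 * (L / t) := by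
        rw [tilt, div_pow, mul_pow, Real.sq_sqrt t.cast_nonneg, hv]
        field_simp
        ring

end Extent

/-- At `ε = 0` the two exponents add up to `-a ^ 2 / 4 + 2 * α`, and the bound is continuous. -/
lemma exists_slack {a α c : ℝ} (h : α < (1 - 4 * Real.exp (-a ^ 2 / 4 + 2 * α)) * c) :
    ∃ ε, 0 < ε ∧ ε < 1 ∧ α < (1 - 4 * Real.exp (-((1 - ε) * a ^ 2 / 2)) *
      Real.exp (2 * ((1 + ε) * a ^ 2 / 8) + 2 * α + ε)) * (1 - ε) * c := by
  have hcont : Continuous fun ε : ℝ => (1 - 4 * Real.exp (-((1 - ε) * a ^ 2 / 2)) *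
      Real.exp (2 * ((1 + ε) * a ^ 2 / 8) + 2 * α + ε)) * (1 - ε) * c := by fun_prop
  have hzero : α < (1 - 4 * Real.exp (-((1 - (0 : ℝ)) * a ^ 2 / 2)) *
      Real.exp (2 * ((1 + 0) * a ^ 2 / 8) + 2 * α + 0)) * (1 - 0) * c := by
    convert h using 2
    rw [mul_assoc 4, ← Real.exp_add, sub_zero, mul_one]
    ring_nf
  have hsmall := ((hcont.tendsto 0).eventually_const_lt hzero).and (eventually_lt_nhds one_pos)
  obtain ⟨ε, ⟨hrate, hε1⟩, hε⟩ :=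
    ((hsmall.filter_mono nhdsWithin_le_nhds).and (self_mem_nhdsWithin (s := Set.Ioi 0))).exists
  exact ⟨ε, hε, hε1, hrate⟩

section Survival

variable {p p₀ a α A B : ℝ} {l₀ : List Dir} {Ω : Type*} [MeasurableSpace Ω] {μ : Measure Ω}
  {ξ : ℕ → Ω → Outcome} {Z : ℕ → Ω → ℕ}

lemma tendsto_startTime (hp₀ : p₀ < 1) (hA : 0 < A) (hl₀ : 0 < l₀.length) :
    Tendsto (startTime p₀ A B l₀.length) atTop atTop :=
  (strictMono_startTime hp₀ hA hl₀).tendsto_atTop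

lemma cast_startTime_succ {t₀ : ℕ} (i : ℕ) : (startTime p₀ A B t₀ (i + 1) : ℝ) =
    startTime p₀ A B t₀ i + phaseLength p₀ A B (startTime p₀ A B t₀ i) := by
  rw [startTime, Nat.cast_add]

lemma tendsto_startTime_succ_div (hp₀ : p₀ < 1) (hA : 0 < A) (hB : 0 ≤ B) (hl₀ : 0 < l₀.length) :
    Tendsto (fun i => (startTime p₀ A B l₀.length (i + 1) : ℝ) / startTime p₀ A B l₀.length i)
      atTop (nhds 1) := by
  have hlim := ((tendsto_phaseLength_div hp₀ hA.le hB).comp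
    (tendsto_startTime hp₀ hA hl₀ (B := B))).const_add 1
  rw [add_zero] at hlim
  refine hlim.congr fun i => ?_
  have hpos : (0 : ℝ) < startTime p₀ A B l₀.length i := Nat.cast_pos.mpr (startTime_pos hl₀ i)
  rw [cast_startTime_succ, add_div, div_self hpos.ne']
  rfl

lemma eventually_le_mul_sqrt_startTime_div (hp₀ : p₀ < 1) (hA : 0 < A) (hB : 0 ≤ B)
    (hl₀ : 0 < l₀.length) {c c' : ℝ} (hc : c < c') :
    ∀ᶠ i in atTop, c ≤
      c' * √((startTime p₀ A B l₀.length i : ℝ) / startTime p₀ A B l₀.length (i + 1)) := by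
  have hlim : Tendsto (fun i => √((startTime p₀ A B l₀.length i : ℝ) /
      startTime p₀ A B l₀.length (i + 1))) atTop (nhds 1) := by
    simpa only [inv_div, inv_one, Real.sqrt_one] using
      ((tendsto_startTime_succ_div hp₀ hA hB hl₀).inv₀ one_ne_zero).sqrt
  exact (hlim.const_mul c').eventually_const_le (by rwa [mul_one])

lemma eventually_mul_startTime_succ_sub_div_le (hp₀ : p₀ < 1) (hA : 0 < A) (hB : 0 < B)
    (hl₀ : 0 < l₀.length) {ε κ : ℝ} (hrate : α < κ * (1 - ε) * ((1 - p₀) ^ 2 / (4 * A * B))) :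
    ∀ᶠ i in atTop, α * (((startTime p₀ A B l₀.length (i + 1) : ℝ) -
        startTime p₀ A B l₀.length i) / startTime p₀ A B l₀.length i) ≤
      (1 - ε) / maxShift p₀ (startTime p₀ A B l₀.length i) * κ := by
  have hlim := ((tendsto_phaseLength_mul_maxShift_div hp₀ hA.le hB.le).comp
    (tendsto_startTime hp₀ hA hl₀ (B := B))).const_mul α
  have := sub_pos.mpr hp₀
  rw [← inv_div _ (_ ^ 2), ← div_eq_mul_inv, lt_div_iff₀ (by positivity)] at hrate
  filter_upwards [hlim.eventually_le_const hrate] with i hi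
  have hM : (0 : ℝ) < maxShift p₀ (startTime p₀ A B l₀.length i) :=
    Nat.cast_pos.mpr (maxShift_pos (startTime_pos hl₀ i))
  rw [cast_startTime_succ, add_sub_cancel_left, div_mul_eq_mul_div, le_div_iff₀ hM,
    mul_comm (1 - ε)]
  exact hi.trans_eq' (by simp only [Function.comp]; ring)

namespace IsSweepingRandomness

variable [IsProbabilityMeasure μ]

lemma eventually_survivalMean_exp_succ_le (h : IsSweepingRandomness μ p p₀ A B l₀.length ξ Z)
    {ε K : ℝ} {τ : ℕ → ℕ} {ρ : ℕ → ℝ} (hp₀ : p₀ < 1) (ha : 0 < a) (hA : 0 < A) (hB : 0 < B)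
    (hAa : a ^ 2 * (p₀ / 2 * (3 - 2 * p₀)) ≤ A ^ 2) (hBa : a ^ 2 * (p₀ / 2) ≤ B ^ 2)
    (hp : 0 ≤ p) (hpp₀ : p ≤ p₀) (hl₀ : 0 < l₀.length) (home : ℤ × ℤ) (hε : 0 < ε) (hK : 0 < K)
    (hτ : τ = startTime p₀ A B l₀.length) (hρ : ∀ i, ρ i = √((τ i : ℝ) / τ (i + 1)))
    (e : Dir) :
    ∀ᶠ i in atTop, survivalMean μ p₀ A B l₀ ξ Z home (i + 1)
        (fun v => Real.exp (tilt p p₀ a A B e (τ (i + 1)) * e.comp v)) ≤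
      (ρ i * K ^ (ρ i - 1) * survivalMean μ p₀ A B l₀ ξ Z home i
          (fun v => Real.exp (tilt p p₀ a A B e (τ i) * e.comp v)) +
        (1 - ρ i) * K ^ ρ i * survivalMean μ p₀ A B l₀ ξ Z home i fun _ => 1) *
      Real.exp ((1 + ε) * a ^ 2 / 8 * (1 - ρ i ^ 2)) := by
  have hp1 : p < 1 := hpp₀.trans_lt hp₀
  have hr := sweptExtent_pos hp₀ hA hB hp1 e
  set v := sweptExtent p p₀ A B e ^ 2 / a ^ 2
  have hτ_lim : Tendsto τ atTop atTop := hτ ▸ tendsto_startTime hp₀ hA hl₀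
  have htilt_lim := (tendsto_tilt (p := p) (p₀ := p₀) (a := a) (A := A) (B := B) e).comp
    (hτ_lim.comp (tendsto_add_atTop_nat 1))
  filter_upwards [hτ_lim.eventually (eventually_sum_stepVar_le hp₀ ha hA hB hAa hBa hp hpp₀
      (show 0 < ε * v / 2 by positivity) e),
    htilt_lim.eventually_le_const (show (0 : ℝ) < 1 / 2 by norm_num),
    htilt_lim.eventually_le_const (show 0 < ε * v / 32 by positivity)] with i hvar hhalf hsmall
  have hτ_pos (j) : 0 < τ j := hτ ▸ startTime_pos hl₀ j
  have hτ_pos' (j) : (0 : ℝ) < τ j := Nat.cast_pos.mpr (hτ_pos j)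
  have hτ_succ : (τ (i + 1) : ℝ) = τ i + phaseLength p₀ A B (τ i) := hτ ▸ cast_startTime_succ i
  have hρ0 : 0 ≤ ρ i := hρ i ▸ Real.sqrt_nonneg _
  have hρ_sq : 1 - ρ i ^ 2 = phaseLength p₀ A B (τ i) / τ (i + 1) := by
    rw [hρ, Real.sq_sqrt (by positivity), one_sub_div (hτ_pos' _).ne', hτ_succ,
      add_sub_cancel_left]
  have hρ1 : ρ i ≤ 1 := by
    rw [← sq_le_one_iff₀ hρ0, ← sub_nonneg, hρ_sq]
    positivity
  have hmean := survivalMean_exp_mul_le (μ := μ) (p₀ := p₀) (A := A) (B := B) (l₀ := l₀) (ξ := ξ)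
    (Z := Z) home i e (s := tilt p p₀ a A B e (τ i)) hK hρ0 hρ1
  rw [hρ, sqrt_div_mul_tilt (hτ_pos i), ← hρ] at hmean
  refine (h.survivalMean_exp_succ_le hp₀ hA hl₀ hp hp1.le home (congrFun hτ i)
    (tilt_nonneg hp₀ hA hB hp1 e _) hhalf e hvar).trans ?_
  rw [mul_comm, hρ_sq]
  exact mul_le_mul hmean (Real.exp_le_exp.mpr
    (tilt_sq_mul_le hp₀ ha hA hB hp1 e rfl (Nat.cast_nonneg _) hsmall)) (Real.exp_pos _).le
    ((survivalMean_nonneg home i fun _ => (Real.exp_pos _).le).trans hmean)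

lemma eventually_survivalMean_one_succ_le (h : IsSweepingRandomness μ p p₀ A B l₀.length ξ Z)
    {ε : ℝ} {τ : ℕ → ℕ} (hp₀ : p₀ < 1) (hA : 0 < A) (hB : 0 < B)
    (hp : 0 ≤ p) (hp1 : p < 1) (hl₀ : 0 < l₀.length) (home : ℤ × ℤ) (hε : 0 < ε) (hε1 : ε ≤ 1)
    (hτ : τ = startTime p₀ A B l₀.length) :
    ∀ᶠ i in atTop, survivalMean μ p₀ A B l₀ ξ Z home (i + 1) (fun _ => 1) ≤
      (1 - (1 - ε) / maxShift p₀ (τ i)) * survivalMean μ p₀ A B l₀ ξ Z home i (fun _ => 1) +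
      (1 - ε) / maxShift p₀ (τ i) * (Real.exp (-((1 - ε) * a ^ 2 / 2)) *
        ∑ e, survivalMean μ p₀ A B l₀ ξ Z home i
          (fun v => Real.exp (tilt p p₀ a A B e (τ i) * e.comp v))) := by
  have hτ_lim : Tendsto τ atTop atTop := hτ ▸ tendsto_startTime hp₀ hA hl₀
  filter_upwards [hτ_lim.eventually
    (eventually_one_sub_le_sum_wordProb_hits hp₀ hA hB hp hp1 hε hε home)] with i hhit
  exact h.survivalMean_one_succ_le hp₀ hA hl₀ hp hp1.le home (congrFun hτ i) hε1
    (fun e => tilt_nonneg hp₀ hA hB hp1 e _)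
    (fun e => by rw [tilt_mul_mul_sqrt hp₀ hA hB hp1 ε e (hτ ▸ startTime_pos hl₀ i)]) hhit

lemma exists_survivalMean_le (h : IsSweepingRandomness μ p p₀ A B l₀.length ξ Z)
    (hp₀ : p₀ < 1) (hα : 0 ≤ α) (ha : 0 < a) (hA : 0 < A) (hB : 0 < B)
    (hAa : a ^ 2 * (p₀ / 2 * (3 - 2 * p₀)) ≤ A ^ 2) (hBa : a ^ 2 * (p₀ / 2) ≤ B ^ 2)
    (hcond : α < (1 - 4 * Real.exp (-a ^ 2 / 4 + 2 * α)) * ((1 - p₀) ^ 2 / (4 * A * B)))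
    (hp : 0 ≤ p) (hpp₀ : p ≤ p₀) (hl₀ : 0 < l₀.length) (home : ℤ × ℤ) :
    ∃ C, ∀ᶠ i in atTop, survivalMean μ p₀ A B l₀ ξ Z home i (fun _ => 1) ≤
      C * (startTime p₀ A B l₀.length i : ℝ) ^ (-α) := by
  obtain ⟨ε, hε, hε1, hrate⟩ := exists_slack hcond
  obtain ⟨K, hK⟩ : ∃ K, K = Real.exp (2 * ((1 + ε) * a ^ 2 / 8) + 2 * α + ε) := ⟨_, rfl⟩
  obtain ⟨τ, hτ⟩ : ∃ τ, τ = startTime p₀ A B l₀.length := ⟨_, rfl⟩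
  obtain ⟨ρ, hρ⟩ : ∃ ρ : ℕ → ℝ, ∀ i, ρ i = √((τ i : ℝ) / τ (i + 1)) := ⟨_, fun _ => rfl⟩
  have hτ_pos (i) : (0 : ℝ) < τ i := Nat.cast_pos.mpr (hτ ▸ startTime_pos hl₀ i)
  have hM (i) : (1 : ℝ) ≤ maxShift p₀ (τ i) :=
    Nat.one_le_cast.mpr (maxShift_pos (Nat.cast_pos.mp (hτ_pos i)))
  have hρ1 (i) : ρ i ≤ 1 := hρ i ▸ Real.sqrt_le_one.mpr ((div_le_one (hτ_pos _)).mpr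
    (Nat.cast_le.mpr (hτ ▸ (strictMono_startTime hp₀ hA hl₀).monotone i.le_succ)))
  have hρε := eventually_le_mul_sqrt_startTime_div hp₀ hA hB.le hl₀
    (show 2 * α < 2 * α + ε by linarith)
  simp only [← hτ, ← hρ] at hρε ⊢
  rw [← hK] at hrate
  obtain ⟨i₀, hi₀⟩ := eventually_atTop.mp <| hρε.and <|
    (eventually_mul_startTime_succ_sub_div_le hp₀ hA hB hl₀ hrate).and <|
    (h.eventually_survivalMean_one_succ_le (a := a) hp₀ hA hB hp (hpp₀.trans_lt hp₀) hl₀ home hε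
      hε1.le hτ).and <| eventually_all.mpr fun e => h.eventually_survivalMean_exp_succ_le
        hp₀ ha hA hB hAa hBa hp hpp₀ hl₀ home hε (hK ▸ Real.exp_pos _) hτ hρ e
  rw [← hτ] at hi₀
  obtain ⟨C, hC⟩ := exists_forall_le_mul_rpow_neg
    (f := fun i => survivalMean μ p₀ A B l₀ ξ Z home i fun _ => 1)
    (F := fun e i => survivalMean μ p₀ A B l₀ ξ Z home i
      fun v => Real.exp (tilt p p₀ a A B e (τ i) * e.comp v)) hα (by positivity)
    (Real.exp_pos _).le hK (fun i _ => hτ_pos i) (fun i _ => hρ i) (fun i _ => hρ1 i)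
    (fun i hi => (hi₀ i hi).1)
    (fun i _ => div_nonneg (sub_nonneg.mpr hε1.le) (by linarith [hM i]))
    (fun i _ => div_le_one_of_le₀ (by linarith [hM i]) (by linarith [hM i]))
    (fun i hi e => (hi₀ i hi).2.2.2 e) (fun i hi => (hi₀ i hi).2.2.1)
    fun i hi => (hi₀ i hi).2.1
  exact ⟨C, eventually_atTop.mpr ⟨i₀, hC⟩⟩

end IsSweepingRandomness

end Survival

/-! ### From the starting times of the phases to all times -/

lemma isBigO_rpow_neg_of_subseq {f : ℕ → ℝ} {τ : ℕ → ℕ} {α C : ℝ} (hf : ∀ t, 0 ≤ f t)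
    (hf_anti : Antitone f) (hτ : StrictMono τ)
    (hτ_lim : Tendsto (fun i => (τ (i + 1) : ℝ) / τ i) atTop (nhds 1)) (hα : 0 ≤ α)
    (hfC : ∀ᶠ i in atTop, f (τ i) ≤ C * (τ i : ℝ) ^ (-α)) :
    f =O[atTop] fun t : ℕ => (t : ℝ) ^ (-α) := by
  obtain ⟨i₀, hi₀⟩ := eventually_atTop.mp
    (hfC.and (hτ_lim.eventually_le_const (show (1 : ℝ) < 2 by norm_num)))
  refine Asymptotics.IsBigO.of_bound (C * 2 ^ α)
    ((eventually_gt_atTop (τ (i₀ + 1))).mono fun t ht => ?_)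
  obtain ⟨i, hit, hti⟩ := hτ.exists_between_of_tendsto_atTop hτ.tendsto_atTop
    ((hτ i₀.succ_pos).trans ht)
  have hi : i₀ < i := Nat.lt_of_succ_lt_succ (hτ.lt_iff_lt.mp (ht.trans_le hti))
  have hτi : (0 : ℝ) < τ i :=
    Nat.cast_pos.mpr ((Nat.zero_le _).trans_lt (hτ (i₀.zero_le.trans_lt hi)))
  obtain ⟨hfi, hdouble⟩ := hi₀ i hi.le
  have hC : 0 ≤ C := nonneg_of_mul_nonneg_left ((hf _).trans hfi) (Real.rpow_pos_of_pos hτi _)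
  have ht_half : (t : ℝ) / 2 ≤ τ i := by
    linarith [(div_le_iff₀ hτi).mp hdouble, (Nat.cast_le (α := ℝ)).mpr hti]
  have ht_pos : (0 : ℝ) < t := Nat.cast_pos.mpr ((Nat.zero_le _).trans_lt hit)
  rw [Real.norm_of_nonneg (hf t), Real.norm_of_nonneg (by positivity)]
  calc f t ≤ C * (τ i : ℝ) ^ (-α) := (hf_anti hit.le).trans hfi
    _ ≤ C * ((t : ℝ) / 2) ^ (-α) := mul_le_mul_of_nonneg_left
        (Real.rpow_le_rpow_of_nonpos (by positivity) ht_half (neg_nonpos.mpr hα)) hC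
    _ = C * 2 ^ α * (t : ℝ) ^ (-α) := by
        rw [Real.div_rpow ht_pos.le zero_le_two, Real.rpow_neg zero_le_two, div_inv_eq_mul]
        ring

lemma toENNReal_le_tsum_ite (x : ℕ∞) :
    (x : ENNReal) ≤ ∑' t : ℕ, if (t : ℕ∞) < x then 1 else 0 := by
  cases x with
  | top => simp
  | coe n =>
    calc ((n : ℕ∞) : ENNReal) = ∑ t ∈ Finset.range n, if (t : ℕ∞) < n then 1 else 0 := by
          rw [Finset.sum_congr rfl fun t ht =>
            if_pos (Nat.cast_lt.mpr (Finset.mem_range.mp ht))]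
          simp
      _ ≤ _ := ENNReal.sum_le_tsum _

lemma lintegral_toENNReal_lt_top {Ω : Type*} [MeasurableSpace Ω] {μ : Measure Ω}
    [IsFiniteMeasure μ] {T : Ω → ℕ∞}
    (hT : Summable fun t : ℕ => μ.real {ω | (t : ℕ∞) < T ω}) :
    ∫⁻ ω, (T ω : ENNReal) ∂μ < ⊤ := by
  -- The time `T` need not be measurable, so its tail events are replaced by measurable hulls.
  let S (t : ℕ) : Set Ω := toMeasurable μ {ω | (t : ℕ∞) < T ω}
  have hS (t : ℕ) : MeasurableSet (S t) := measurableSet_toMeasurable _ _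
  calc ∫⁻ ω, (T ω : ENNReal) ∂μ
      ≤ ∫⁻ ω, ∑' t : ℕ, (S t).indicator 1 ω ∂μ := by
        refine lintegral_mono fun ω => (toENNReal_le_tsum_ite _).trans
          (ENNReal.tsum_le_tsum fun t => ?_)
        split_ifs with ht
        · rw [Set.indicator_of_mem (subset_toMeasurable _ _ (by exact ht))]
          rfl
        · exact zero_le
    _ = ∑' t : ℕ, ENNReal.ofReal (μ.real {ω | (t : ℕ∞) < T ω}) := by
        rw [lintegral_tsum fun t => (measurable_one.indicator (hS t)).aemeasurable]
        refine tsum_congr fun t => ?_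
        rw [lintegral_indicator_one (hS t), measure_toMeasurable, ofReal_measureReal]
    _ < ⊤ := by
        rw [← ENNReal.ofReal_tsum_of_nonneg (fun _ => measureReal_nonneg) hT]
        exact ENNReal.ofReal_lt_top

lemma IsSweepingRandomness.isBigO_lt_sweepingTime {p p₀ a α A B : ℝ} {l₀ : List Dir} {Ω : Type*}
    [MeasurableSpace Ω] {μ : Measure Ω} [IsProbabilityMeasure μ] {ξ : ℕ → Ω → Outcome}
    {Z : ℕ → Ω → ℕ} (h : IsSweepingRandomness μ p p₀ A B l₀.length ξ Z) (hp₀ : p₀ < 1)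
    (hα : 0 ≤ α) (ha : 0 < a) (hA : 0 < A) (hB : 0 < B)
    (hAa : a ^ 2 * (p₀ / 2 * (3 - 2 * p₀)) ≤ A ^ 2) (hBa : a ^ 2 * (p₀ / 2) ≤ B ^ 2)
    (hcond : α < (1 - 4 * Real.exp (-a ^ 2 / 4 + 2 * α)) * ((1 - p₀) ^ 2 / (4 * A * B)))
    (hp : 0 ≤ p) (hpp₀ : p ≤ p₀) (hl₀ : 0 < l₀.length) (home : ℤ × ℤ) :
    (fun t : ℕ => μ.real {ω | (t : ℕ∞) < sweepingTime p₀ A B l₀ ξ Z home ω})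
      =O[atTop] fun t : ℕ => (t : ℝ) ^ (-α) := by
  obtain ⟨C, hC⟩ := h.exists_survivalMean_le hp₀ hα ha hA hB hAa hBa hcond hp hpp₀ hl₀ home
  exact isBigO_rpow_neg_of_subseq (fun _ => measureReal_nonneg)
    (fun s t hst => measureReal_mono (Set.ofPred_subset_ofPred.mpr fun _ =>
      (Nat.cast_le.mpr hst).trans_lt))
    (strictMono_startTime hp₀ hA hl₀) (tendsto_startTime_succ_div hp₀ hA hB.le hl₀) hα
    (hC.mono fun i hi => (h.measureReal_lt_sweepingTime_le hp₀ hA hl₀ home i).trans hi)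

lemma mul_sqrt_sq (a : ℝ) {x : ℝ} (hx : 0 ≤ x) : (a * √x) ^ 2 = a ^ 2 * x := by
  rw [mul_pow, Real.sq_sqrt hx]

lemma four_mul_sweep_area (a : ℝ) {p₀ : ℝ} (hp₀ : 0 ≤ p₀) :
    4 * (a * √(p₀ / 2) * √(3 - 2 * p₀)) * (a * √(p₀ / 2)) =
      2 * a ^ 2 * p₀ * √(3 - 2 * p₀) := by
  linear_combination 4 * √(3 - 2 * p₀) * mul_sqrt_sq a (div_nonneg hp₀ zero_le_two)

end GuidedWalk

theorem mainTheorem3_general (p₀ α a A B : ℝ) (hp₀ : p₀ < 1) (hα : 0 ≤ α) (ha : 0 < a)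
    (hA : 0 < A) (hB : 0 < B) (hAa : a ^ 2 * (p₀ / 2 * (3 - 2 * p₀)) ≤ A ^ 2)
    (hBa : a ^ 2 * (p₀ / 2) ≤ B ^ 2)
    (hcond : α < (1 - 4 * Real.exp (-a ^ 2 / 4 + 2 * α)) * ((1 - p₀) ^ 2 / (4 * A * B)))
    (p : ℝ) (hp : 0 ≤ p) (hpp₀ : p ≤ p₀) (l₀ : List GuidedWalk.Dir) (hl₀ : 2 ≤ l₀.length)
    {Ω : Type*} [MeasurableSpace Ω] (μ : Measure Ω) [IsProbabilityMeasure μ]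
    (ξ : ℕ → Ω → GuidedWalk.Outcome) (Z : ℕ → Ω → ℕ)
    (hrand : GuidedWalk.IsSweepingRandomness μ p p₀ A B l₀.length ξ Z) (home : ℤ × ℤ) :
    ((fun t : ℕ => μ.real {ω | (t : ℕ∞) < GuidedWalk.sweepingTime p₀ A B l₀ ξ Z home ω})
        =O[atTop] fun t : ℕ => (t : ℝ) ^ (-α)) ∧
      (1 < α → ∫⁻ ω, (GuidedWalk.sweepingTime p₀ A B l₀ ξ Z home ω : ENNReal) ∂μ < ⊤) := by
  have htail := hrand.isBigO_lt_sweepingTime hp₀ hα ha hA hB hAa hBa hcond hp hpp₀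
    (two_pos.trans_le hl₀) home
  refine ⟨htail, fun hα1 => GuidedWalk.lintegral_toENNReal_lt_top ?_⟩
  exact summable_of_isBigO_nat (Real.summable_nat_rpow.mpr (neg_lt_neg hα1)) htail

theorem mainTheorem3 (p₀ α a A B : ℝ) (hp₀ : 0 < p₀) (hp₀' : p₀ < 1) (hα : 0 < α) (ha : 0 < a)
    (hcond : (1 - 4 * Real.exp (-a ^ 2 / 4 + 2 * α)) *
      ((1 - p₀) ^ 2 / (2 * a ^ 2 * p₀ * √(3 - 2 * p₀))) > α)
    (hA : A = a * √(p₀ / 2) * √(3 - 2 * p₀)) (hB : B = a * √(p₀ / 2))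
    (p : ℝ) (hp : 0 ≤ p) (hpp₀ : p ≤ p₀)
    (l₀ : List GuidedWalk.Dir) (hl₀ : 2 ≤ l₀.length) (hl₀' : GuidedWalk.displacement l₀ = 0)
    {Ω : Type*} [MeasurableSpace Ω] (μ : MeasureTheory.Measure Ω)
    [MeasureTheory.IsProbabilityMeasure μ]
    (ξ : ℕ → Ω → GuidedWalk.Outcome) (Z : ℕ → Ω → ℕ)
    (hrand : GuidedWalk.IsSweepingRandomness μ p p₀ A B l₀.length ξ Z) (home : ℤ × ℤ) :
    ((fun t : ℕ => μ.real {ω | (t : ℕ∞) < GuidedWalk.sweepingTime p₀ A B l₀ ξ Z home ω})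
        =O[Filter.atTop] fun t : ℕ => (t : ℝ) ^ (-α)) ∧
      (1 < α →
        ∫⁻ ω, (GuidedWalk.sweepingTime p₀ A B l₀ ξ Z home ω : ENNReal) ∂μ < ⊤) := by
  subst hA hB
  rw [← GuidedWalk.four_mul_sweep_area a hp₀.le] at hcond
  have hp₀2 : 0 < p₀ / 2 := by positivity
  have hp₀3 : 0 < 3 - 2 * p₀ := by linarith
  refine mainTheorem3_general p₀ α a _ _ hp₀' hα.le ha (by positivity) (by positivity) ?_
    (GuidedWalk.mul_sqrt_sq a hp₀2.le).ge hcond p hp hpp₀ l₀ hl₀ μ ξ Z hrand home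
  rw [GuidedWalk.mul_sqrt_sq _ hp₀3.le, GuidedWalk.mul_sqrt_sq _ hp₀2.le, mul_assoc]
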